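/- Let $N\ge 1$ and $k\ge 0$ be integers and let $\alpha_1,\dots,\alpha_k$ be complex numbers (for instance real). For a unitary matrix $U\in U(N)$ with eigenvalues $e^{i\theta_1},\dots,e^{i\theta_N}$ ($\theta_n$ real, listed with multiplicity) put $$Z(\theta)=\det\left(I-Ue^{-i\theta}\right)=\prod_{m=1}^N\left(1-e^{i\theta_m}e^{-i\theta}\right),$$ and let $\mathbb{E}_N$ denote the expectation over normalised Haar measure on $U(N)$. Let $h_m(x_1,\dots,x_n)=\sum_{m_1+\dots+m_n=m,\ m_i\ge 0}x_1^{m_1}\cdots x_n^{m_n}$ be the complete homogeneous symmetric polynomial of degree $m$. Then $$\mathbb{E}_N\left[\frac1N\sum_{n=1}^N Z(\theta_n+\alpha_1)\cdots Z(\theta_n+\alpha_k)\right]=\frac1N\prod_{r=1}^k\left(1-e^{-i\alpha_r}\right)h_{N-1}\left(e^{-i\alpha_1},\dots,e^{-i\alpha_k},1,1\right),$$ where $h_{N-1}$ is taken in $k+2$ variables. If moreover the numbers $e^{-i\alpha_1},\dots,e^{-i\alpha_k}$ are pairwise distinct and all different from $1$, then the same expectation also equals $$\frac1N\left(\sum_{r=1}^k\frac{e^{-i(N+k)\alpha_r}}{1-e^{-i\alpha_r}}\prod_{\substack{j=1\\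 j\ne r}}^k\frac{1-e^{-i\alpha_j}}{e^{-i\alpha_r}-e^{-i\alpha_j}}+N+k-\sum_{\ell=1}^k\frac1{1-e^{-i\alpha_\ell}}\right).$$ -/

import Mathlib

open MeasureTheory

/-- The unitary group `U(N)` is compact. -/
instance unitaryGroup_compactSpace (N : ℕ) : CompactSpace (Matrix.unitaryGroup (Fin N) ℂ) := by
  have hK : IsCompact (Set.univ.pi fun _ : Fin N => Set.univ.pi fun _ : Fin N =>
      Metric.closedBall (0 : ℂ) 1) :=
    isCompact_univ_pi fun _ => isCompact_univ_pi fun _ => isCompact_closedBall 0 1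
  refine (isCompact_iff_compactSpace
    (s := (Matrix.unitaryGroup (Fin N) ℂ : Set (Matrix (Fin N) (Fin N) ℂ)))).mp ?_
  refine hK.of_isClosed_subset (isClosed_unitary (R := Matrix (Fin N) (Fin N) ℂ)) ?_
  intro U hU i _ j _
  rw [mem_closedBall_zero_iff]
  exact entry_norm_bound_of_unitary hU i j

/-- The Borel σ-algebra of `U(N)`. -/
noncomputable instance unitaryGroup_measurableSpace (N : ℕ) :
    MeasurableSpace (Matrix.unitaryGroup (Fin N) ℂ) :=
  borel _

instance unitaryGroup_borelSpace (N : ℕ) : BorelSpace (Matrix.unitaryGroup (Fin N) ℂ) :=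
  ⟨rfl⟩

/-- Haar measure on `U(N)`, normalised to have total mass `1`. -/
noncomputable def haarU (N : ℕ) : Measure (Matrix.unitaryGroup (Fin N) ℂ) :=
  Measure.haarMeasure ⊤

/-- The characteristic polynomial `Z_U(θ) = det (I - U e^{-iθ})`, which is
`∏ m, (1 - e^{iθ_m} e^{-iθ})` if `e^{iθ_m}` are the eigenvalues of `U`. -/
noncomputable def Z {N : ℕ} (U : Matrix.unitaryGroup (Fin N) ℂ) (θ : ℂ) : ℂ :=
  (1 - Complex.exp (-Complex.I * θ) • (U : Matrix (Fin N) (Fin N) ℂ)).det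

/-- The eigenangles `θ_1, …, θ_N ∈ (-π, π]` of `U`: the arguments of its eigenvalues, listed with
multiplicity. -/
noncomputable def eigenangles {N : ℕ} (U : Matrix.unitaryGroup (Fin N) ℂ) : Multiset ℝ :=
  (U : Matrix (Fin N) (Fin N) ℂ).charpoly.roots.map Complex.arg

/-- `(1/N) ∑_n Z_U(θ_n + α_1) ⋯ Z_U(θ_n + α_k)`, the sum over the eigenangles of `U`. -/
noncomputable def shiftedMean {N k : ℕ} (α : Fin k → ℂ) (U : Matrix.unitaryGroup (Fin N) ℂ) : ℂ :=
  1 / (N : ℂ) * ((eigenangles U).map fun t : ℝ => ∏ r, Z U ((t : ℂ) + α r)).sum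

/-!
The proof uses of Haar measure only its invariance under left translations, and reduces the mean to
a Toeplitz determinant.

**Loop equations.** Invariance under `U ↦ (1 + t v v*) U`, for the infinitely many `t` for which
`1 + t v v*` is unitary, is a polynomial identity in `t`. Applied to
`∏ r, det (x_r - U) * (det U) ^ (-m)`, its coefficients of `t` and `t ^ 2`, summed over suitable `v`,
give the trace identities `coeffwise_sum_trace` and `coeffwise_sum_trace_mul_trace`. By Jacobi's
formula and the resolvent identity, the traces are expressed by the Euler operators
`θ_r = x_r ∂/∂x_r`. Hence the mean `charMoment`, multiplied by the Vandermonde product, is an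
eigenfunction of `∑ r, θ_r` and essentially of `∑ r, θ_r ^ 2`
(`sum_theta_vdm_mul_charMoment`, `sum_theta_theta_vdm_mul_charMoment`).

**The Heine–Szegő identity.** The two eigenvalues prescribe the sum and the sum of squares of the
exponents of every monomial that occurs. As these exponents are distinct and less than `n + N`, they
must be the complement of the block `m, …, m + N - 1` (`not_mem_block_of_coeff_ne_zero`). So the
product is a multiple of one alternant, and dividing by the Vandermonde product yields a
Toeplitz determinant in the coefficients of `∏ r, (T - x_r)`. The constant is found at
`x = (0, …, 0, 1, …, 1)`. The result is `haarMean_detAeval`: the mean of `det (P(U) U ^ (-m))` is the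
determinant of the matrix with entries `(P T ^ j).coeff (m + i)`.

**The eigenvalue sum.** With `a_r = exp (-i α_r)` and `P = ∏ r, (1 - a_r T)`, the sum
`∑ n, ∏ r, Z(θ_n + α_r)` is `∑ n, q(λ_n⁻¹)` for `q(w) = ∏ r, det (1 - a_r w U)`, that is
`∑ J, q_J tr (U* ^ J)`. Since the mean is invariant under `U ↦ w U` with `|w| = 1`, the coefficient
`q_J` may be replaced by `q(1) = det P(U)`. Taking the Heine–Szegő identity for `P (T ^ J + ε)` to
first order in `ε` gives the mean of `det P(U) tr (U* ^ J)` as a trace against the inverse of a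
unitriangular Toeplitz matrix, whose entries are the coefficients of `1 / P`
(`haarMean_detAeval_mul_trace`). Summed over `J` this is `P(1)` times the coefficient of `T ^ (N - 1)`
in `1 / (P (1 - T) ^ 2)`, which is the complete homogeneous symmetric polynomial in question
(`mk_hsymm_append_mul`). The closed form is the partial fraction expansion of this series
(`sum_partialFractionCoeff`).
-/

/-! ### Adjugates of the resolvent matrices -/

section Resolvent

open Matrix Polynomial

variable {S : Type*} [CommRing S] {ι : Type*} [Fintype ι] [DecidableEq ι]

/-- Jacobi's formula for a matrix of polynomials. -/
theorem derivative_det_eq_trace (M : Matrix ι ι S[X]) :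
    derivative M.det = (M.adjugate * M.map derivative).trace := by
  have h : derivative M.det = ∑ i, (M.updateCol i fun j => derivative (M j i)).det := by
    simp only [det_apply, derivative_sum, derivative_smul, derivative_prod_finset,
      Finset.smul_sum]
    rw [Finset.sum_comm]
    refine Finset.sum_congr rfl fun i _ => Finset.sum_congr rfl fun σ _ => ?_
    rw [← Finset.prod_erase_mul _ _ (Finset.mem_univ i)]
    simp only [updateCol_self]
    congr 2
    refine Finset.prod_congr rfl fun j hj => ?_
    rw [updateCol_ne (Finset.ne_of_mem_erase hj)]
  rw [h, trace]
  refine Finset.sum_congr rfl fun i _ => ?_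
  rw [← cramer_apply, cramer_eq_adjugate_mulVec, diag_apply, mul_apply]
  rfl

theorem derivative_charpoly_eq_trace (U : Matrix ι ι S) :
    derivative U.charpoly = U.charmatrix.adjugate.trace := by
  rw [charpoly, derivative_det_eq_trace]
  have : U.charmatrix.map derivative = 1 := by
    ext i j
    by_cases h : i = j
    · subst h; simp
    · simp [h]
  rw [this, mul_one]

theorem eval_derivative_charpoly (U : Matrix ι ι S) (x : S) :
    (derivative U.charpoly).eval x = (scalar ι x - U).adjugate.trace := by
  have h : (U.charmatrix.map (evalRingHom x)) = scalar ι x - U := by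
    ext i j
    by_cases h : i = j
    · subst h; simp
    · simp [h]
  rw [derivative_charpoly_eq_trace, ← h, ← RingHom.mapMatrix_apply, ← RingHom.map_adjugate]
  simp [trace, eval_finsetSum]

/-- The matrix determinant lemma, with the adjugate in place of the inverse. -/
theorem det_add_vecMulVec (A : Matrix ι ι S) (u v : ι → S) :
    (A + vecMulVec u v).det = A.det + v ⬝ᵥ (A.adjugate *ᵥ u) := by
  -- It suffices to treat `X - (-A)` over `S[X]`, whose determinant is monic, hence regular.
  have key : ∀ {S' : Type _} [CommRing S'] (B : Matrix ι ι S') (a b : ι → S'),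
      IsRegular B.det → (B + vecMulVec a b).det = B.det + b ⬝ᵥ (B.adjugate *ᵥ a) := by
    intro S' _ B a b hB
    rcases isEmpty_or_nonempty ι with hι | hι
    · simp
    have h1 : (B.adjugate * (B + vecMulVec a b)).det =
        B.det ^ (Fintype.card ι - 1) * (B.det + b ⬝ᵥ (B.adjugate *ᵥ a)) := by
      rw [mul_add, adjugate_mul, mul_vecMulVec]
      have := eval_charpoly (-vecMulVec (B.adjugate *ᵥ a) b) B.det
      rw [sub_neg_eq_add, ← neg_vecMulVec, charpoly_vecMulVec] at this
      rw [smul_one_eq_diagonal]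
      refine this.symm.trans ?_
      obtain ⟨c, hc⟩ : ∃ c, Fintype.card ι = c + 1 :=
        ⟨_, (Nat.sub_add_cancel Fintype.card_pos).symm⟩
      simp only [hc, eval_sub, eval_pow, eval_X, eval_smul, smul_eq_mul, neg_dotProduct,
        Nat.add_sub_cancel, dotProduct_comm b]
      ring
    rw [det_mul, det_adjugate] at h1
    exact (hB.pow _).left h1
  have := key (charmatrix (-A)) (fun i => C (u i)) (fun i => C (v i))
    (charpoly_monic (-A)).isRegular
  have h2 := congrArg (evalRingHom (0 : S)) this
  have hA : (evalRingHom (0 : S)).mapMatrix (charmatrix (-A)) = A := by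
    ext i j
    by_cases h : i = j
    · subst h; simp
    · simp [h]
  have hA' : (evalRingHom (0 : S)).mapMatrix
      (charmatrix (-A) + vecMulVec (fun i => C (u i)) fun i => C (v i)) = A + vecMulVec u v := by
    rw [map_add, hA]
    ext i j
    simp [vecMulVec_apply]
  have hadj : (evalRingHom (0 : S)).mapMatrix (charmatrix (-A)).adjugate = A.adjugate := by
    rw [RingHom.map_adjugate, hA]
  rw [map_add, RingHom.map_det, RingHom.map_det, hA, hA', RingHom.map_dotProduct] at h2
  rw [h2]
  congr 2
  · ext i; simp
  · ext i
    rw [Function.comp_apply, RingHom.map_mulVec, ← RingHom.mapMatrix_apply, hadj]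
    congr 2
    ext i; simp

theorem mul_adjugate_scalar_sub (U : Matrix ι ι S) (x : S) :
    U * (scalar ι x - U).adjugate
      = x • (scalar ι x - U).adjugate - (scalar ι x - U).det • (1 : Matrix ι ι S) := by
  rw [← mul_adjugate, sub_mul]
  simp [← smul_eq_diagonal_mul]

theorem trace_mul_adjugate_scalar_sub (U : Matrix ι ι S) (x : S) :
    (U * (scalar ι x - U).adjugate).trace =
      x * (derivative U.charpoly).eval x - Fintype.card ι * U.charpoly.eval x := by
  rw [mul_adjugate_scalar_sub, trace_sub, trace_smul, trace_smul, trace_one,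
    eval_derivative_charpoly, eval_charpoly, smul_eq_mul, smul_eq_mul, mul_comm (det _)]

/-- The resolvent identity, for the adjugates of `x - U` and `y - U`. -/
theorem sub_smul_mul_adjugate_mul_adjugate (U : Matrix ι ι S) (x y : S) :
    (x - y) • ((U * (scalar ι x - U).adjugate) * (U * (scalar ι y - U).adjugate)) =
      (y * (scalar ι x - U).det) • (U * (scalar ι y - U).adjugate)
        - (x * (scalar ι y - U).det) • (U * (scalar ι x - U).adjugate) := by
  have h : (x - y) • ((scalar ι x - U).adjugate * (scalar ι y - U).adjugate) =
      (scalar ι x - U).det • (scalar ι y - U).adjugate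
        - (scalar ι y - U).det • (scalar ι x - U).adjugate := by
    have e : (x - y) • (1 : Matrix ι ι S) = (scalar ι x - U) - (scalar ι y - U) := by
      ext i j
      by_cases h : i = j
      · subst h; simp
      · simp [h]
    calc _ = (scalar ι x - U).adjugate * ((x - y) • (1 : Matrix ι ι S))
          * (scalar ι y - U).adjugate := by simp
      _ = _ := by
        rw [e, mul_sub, sub_mul, adjugate_mul, mul_assoc, mul_adjugate]
        simp
  rw [mul_adjugate_scalar_sub, mul_adjugate_scalar_sub]
  generalize (scalar ι x - U).adjugate = a at *
  generalize (scalar ι y - U).adjugate = b at *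
  generalize (scalar ι x - U).det = p at *
  generalize (scalar ι y - U).det = q at *
  have : (x - y) • ((x • a - p • (1 : Matrix ι ι S)) * (y • b - q • (1 : Matrix ι ι S))) =
      (x * y) • ((x - y) • (a * b)) - ((x - y) * x * q) • a - ((x - y) * y * p) • b
       + ((x - y) * p * q) • 1 := by
    simp only [sub_mul, mul_sub, smul_mul_assoc, mul_smul_comm, one_mul, mul_one]
    module
  rw [this, h]
  module

end Resolvent

/-! ### The Haar mean as a linear functional -/

section HaarFunctional

open Matrix

/-- The algebra of continuous functions on `U(N)`, in which all class functions below live. -/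
abbrev UFun (N : ℕ) := C(Matrix.unitaryGroup (Fin N) ℂ, ℂ)

theorem integrable_haarU {N : ℕ} (f : UFun N) : Integrable (fun U => f U) (haarU N) := by
  have : IsFiniteMeasure (haarU N) := by unfold haarU; infer_instance
  exact f.continuous.integrable_of_hasCompactSupport (HasCompactSupport.of_compactSpace _)

/-- The expectation over Haar measure, as a linear functional on continuous functions. -/
noncomputable def haarMean (N : ℕ) : UFun N →ₗ[ℂ] ℂ where
  toFun f := ∫ U, f U ∂(haarU N)
  map_add' f g := integral_add (integrable_haarU f) (integrable_haarU g)
  map_smul' c _ := integral_const_mul c _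

theorem haarMean_apply {N : ℕ} (f : UFun N) : haarMean N f = ∫ U, f U ∂(haarU N) := rfl

theorem haarMean_one (N : ℕ) : haarMean N 1 = 1 := by
  have h : haarU N Set.univ = 1 := by
    have := Measure.haarMeasure_self
      (K₀ := (⊤ : TopologicalSpace.PositiveCompacts (Matrix.unitaryGroup (Fin N) ℂ)))
    simpa [haarU] using this
  simp [haarMean_apply, Measure.real, h]

/-- Composition with left translation by `V`. -/
noncomputable def leftTranslate {N : ℕ} (V : Matrix.unitaryGroup (Fin N) ℂ) :
    UFun N →ₐ[ℂ] UFun N :=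
  ContinuousMap.compRightAlgHom ℂ ℂ ⟨fun U => V * U, continuous_const.mul continuous_id⟩

theorem haarMean_leftTranslate {N : ℕ} (V : Matrix.unitaryGroup (Fin N) ℂ) (f : UFun N) :
    haarMean N (leftTranslate V f) = haarMean N f := by
  have : (haarU N).IsMulLeftInvariant := by unfold haarU; infer_instance
  exact integral_mul_left_eq_self (fun U => f U) V

/-- The tautological matrix over `UFun N`, whose `(i, j)` entry is the function `U ↦ U i j`. -/
noncomputable def genericU (N : ℕ) : Matrix (Fin N) (Fin N) (UFun N) :=
  of fun i j => ⟨fun U => (U : Matrix (Fin N) (Fin N) ℂ) i j,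
    (continuous_apply_apply i j).comp continuous_subtype_val⟩

theorem genericU_mul_conjTranspose (N : ℕ) : genericU N * (genericU N)ᴴ = 1 := by
  ext i j U
  have := congrFun (congrFun (mem_unitaryGroup_iff.mp U.2) i) j
  rw [star_eq_conjTranspose, mul_apply] at this
  rw [mul_apply, ContinuousMap.sum_apply]
  refine Eq.trans ?_ (this.trans ?_)
  · rfl
  · by_cases h : i = j
    · subst h; simp
    · simp [h]

theorem leftTranslate_genericU {N : ℕ} (V : Matrix.unitaryGroup (Fin N) ℂ) :
    (genericU N).map (leftTranslate V) =
      (V : Matrix (Fin N) (Fin N) ℂ).map (algebraMap ℂ (UFun N)) * genericU N := by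
  ext i j U
  rw [mul_apply, ContinuousMap.sum_apply]
  rfl

/-- The function `U ↦ (det U)⁻¹`. -/
noncomputable def invDet (N : ℕ) : UFun N := (genericU N)ᴴ.det

theorem det_genericU_mul_invDet (N : ℕ) : (genericU N).det * invDet N = 1 := by
  rw [invDet, ← det_mul, genericU_mul_conjTranspose, det_one]

theorem leftTranslate_invDet {N : ℕ} (V : Matrix.unitaryGroup (Fin N) ℂ) :
    leftTranslate V (invDet N) =
      algebraMap ℂ (UFun N) (star (V : Matrix (Fin N) (Fin N) ℂ).det) * invDet N := by
  have h : leftTranslate V (genericU N).det =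
      algebraMap ℂ (UFun N) (V : Matrix (Fin N) (Fin N) ℂ).det * (genericU N).det := by
    rw [AlgHom.map_det, AlgHom.mapMatrix_apply, leftTranslate_genericU, det_mul,
      ← RingHom.mapMatrix_apply, ← RingHom.map_det]
  have h1 : leftTranslate V (genericU N).det * leftTranslate V (invDet N) = 1 := by
    rw [← map_mul, det_genericU_mul_invDet, map_one]
  have h2 : star (V : Matrix (Fin N) (Fin N) ℂ).det * (V : Matrix (Fin N) (Fin N) ℂ).det = 1 :=
    Unitary.star_mul_self_of_mem (det_of_mem_unitary V.2)
  have h3 := congrArg (algebraMap ℂ (UFun N)) h2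
  rw [map_mul, map_one] at h3
  rw [h] at h1
  calc leftTranslate V (invDet N)
      = (algebraMap ℂ (UFun N) (star (V : Matrix (Fin N) (Fin N) ℂ).det) *
          algebraMap ℂ (UFun N) (V : Matrix (Fin N) (Fin N) ℂ).det) *
          ((genericU N).det * invDet N) * leftTranslate V (invDet N) := by
        rw [h3, det_genericU_mul_invDet, one_mul, one_mul]
    _ = algebraMap ℂ (UFun N) (star (V : Matrix (Fin N) (Fin N) ℂ).det) * invDet N *
          (algebraMap ℂ (UFun N) (V : Matrix (Fin N) (Fin N) ℂ).det * (genericU N).det *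
          leftTranslate V (invDet N)) := by ring
    _ = _ := by rw [h1, mul_one]

end HaarFunctional

/-! ### Comparing coefficients of polynomials -/

section PolynomialIdentity

open Polynomial

/-- Two polynomials that agree, after applying a linear map to the coefficients of one of them, at
infinitely many scalars have the same coefficients. -/
theorem map_coeff_eq_of_infinite {A R : Type*} [CommRing A] [Algebra ℂ A] [CommRing R] [IsDomain R]
    [Algebra ℂ R] (E : A →ₗ[ℂ] R) (P : A[X]) (Q : R[X]) {s : Set ℂ} (hs : s.Infinite)
    (h : ∀ w ∈ s, E (P.eval (algebraMap ℂ A w)) = Q.eval (algebraMap ℂ R w)) (d : ℕ) :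
    E (P.coeff d) = Q.coeff d := by
  set P' : R[X] := ∑ d ∈ Finset.range (P.natDegree + 1), C (E (P.coeff d)) * X ^ d with hP'
  have hcoeff : ∀ d, P'.coeff d = E (P.coeff d) := by
    intro d
    simp only [hP', finsetSum_coeff, coeff_C_mul, coeff_X_pow]
    simp only [mul_ite, mul_one, mul_zero, Finset.sum_ite_eq, Finset.mem_range]
    split_ifs with hd
    · rfl
    · rw [coeff_eq_zero_of_natDegree_lt (by omega), map_zero]
  have heval : ∀ w : ℂ, P'.eval (algebraMap ℂ R w) = E (P.eval (algebraMap ℂ A w)) := by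
    intro w
    rw [eval_eq_sum_range (p := P), map_sum, hP', eval_finsetSum]
    refine Finset.sum_congr rfl fun d _ => ?_
    rw [eval_mul, eval_C, eval_pow, eval_X, ← map_pow, ← map_pow, mul_comm, mul_comm (P.coeff d),
      ← Algebra.smul_def, ← Algebra.smul_def, map_smul]
  have : P' = Q := by
    refine eq_of_infinite_eval_eq _ _ ((hs.image
      ((FaithfulSMul.algebraMap_injective ℂ R).injOn)).mono ?_)
    rintro _ ⟨w, hw, rfl⟩
    simp only [Set.mem_ofPred_eq, heval, h w hw]
  rw [← hcoeff, this]

theorem infinite_norm_eq_one : {w : ℂ | ‖w‖ = 1}.Infinite := by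
  have h : Set.InjOn (fun t : ℝ => Complex.exp (t * Complex.I)) (Set.Icc 0 1) := by
    intro a ha b hb hab
    obtain ⟨n, hn⟩ := Complex.exp_eq_exp_iff_exists_int.mp hab
    have h1 : (a : ℂ) = b + n * (2 * Real.pi) := by
      have := mul_right_cancel₀ Complex.I_ne_zero (a := (a : ℂ)) (c := b + n * (2 * Real.pi))
      apply this; rw [hn]; ring
    have h2 : a = b + n * (2 * Real.pi) := by exact_mod_cast h1
    have h3 : n = 0 := by
      have hpi := Real.pi_gt_three
      rcases lt_trichotomy n 0 with h | h | h
      · have : (n : ℝ) ≤ -1 := by exact_mod_cast (by omega : n ≤ -1)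
        nlinarith [ha.1, ha.2, hb.1, hb.2]
      · exact h
      · have : (1 : ℝ) ≤ n := by exact_mod_cast h
        nlinarith [ha.1, ha.2, hb.1, hb.2]
    simpa [h3] using h2
  refine ((Set.Icc_infinite (by norm_num : (0 : ℝ) < 1)).image h).mono ?_
  rintro _ ⟨t, _, rfl⟩
  exact Complex.norm_exp_ofReal_mul_I t

theorem coeff_one_prod_sub {S : Type*} [CommRing S] {ι : Type*} [DecidableEq ι] (s : Finset ι)
    (a b : ι → S) : (∏ r ∈ s, (C (a r) - X * C (b r))).coeff 1 =
      -∑ r ∈ s, b r * ∏ r' ∈ s.erase r, a r' := by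
  have := coeff_derivative (∏ r ∈ s, (C (a r) - X * C (b r))) 0
  simp only [zero_add, Nat.cast_zero, mul_one] at this
  rw [← this, derivative_prod_finset, coeff_zero_eq_eval_zero, eval_finsetSum,
    ← Finset.sum_neg_distrib]
  refine Finset.sum_congr rfl fun r _ => ?_
  have hd : derivative (C (a r) - X * C (b r)) = C (-b r) := by simp
  rw [hd, eval_mul, eval_C, eval_prod, mul_neg, mul_comm]
  simp

theorem two_mul_coeff_two_prod_sub {S : Type*} [CommRing S] {ι : Type*} [DecidableEq ι]
    (s : Finset ι) (a b : ι → S) : 2 * (∏ r ∈ s, (C (a r) - X * C (b r))).coeff 2 =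
      ∑ r ∈ s, ∑ r' ∈ s.erase r, b r * b r' * ∏ r'' ∈ (s.erase r).erase r', a r'' := by
  have h := coeff_derivative (∏ r ∈ s, (C (a r) - X * C (b r))) 1
  rw [mul_comm, show (((1 : ℕ) : S) + 1) = 2 by norm_num] at h
  rw [← h, derivative_prod_finset, finsetSum_coeff]
  refine Finset.sum_congr rfl fun r _ => ?_
  have hd : derivative (C (a r) - X * C (b r)) = C (-b r) := by simp
  rw [hd, coeff_mul_C, coeff_one_prod_sub, neg_mul_neg, Finset.sum_mul]
  exact Finset.sum_congr rfl fun r' _ => by ring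

end PolynomialIdentity

/-! ### Coefficientwise linear functionals and Euler operators -/

section Coefficientwise

open MvPolynomial

/-- A linear functional applied to each coefficient of a multivariate polynomial. -/
noncomputable def coeffwise {σ A : Type*} [CommRing A] [Algebra ℂ A] (E : A →ₗ[ℂ] ℂ) :
    MvPolynomial σ A →ₗ[ℂ] MvPolynomial σ ℂ where
  toFun P := AddMonoidAlgebra.map E.toAddMonoidHom P
  map_add' P Q := by
    ext κ
    simp only [coeff_addMonoidAlgebraMap, coeff_add, map_add]
  map_smul' c P := by
    ext κ
    simp only [coeff_addMonoidAlgebraMap, coeff_smul, RingHom.id_apply]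
    exact E.map_smul c _

theorem coeff_coeffwise {σ A : Type*} [CommRing A] [Algebra ℂ A] (E : A →ₗ[ℂ] ℂ)
    (P : MvPolynomial σ A) (κ : σ →₀ ℕ) : (coeffwise E P).coeff κ = E (P.coeff κ) := rfl

theorem coeffwise_map_mul {σ A : Type*} [CommRing A] [Algebra ℂ A] (E : A →ₗ[ℂ] ℂ)
    (Q : MvPolynomial σ ℂ) (P : MvPolynomial σ A) :
    coeffwise E (map (algebraMap ℂ A) Q * P) = Q * coeffwise E P := by
  classical
  ext κ
  rw [coeff_coeffwise, coeff_mul, coeff_mul, map_sum]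
  refine Finset.sum_congr rfl fun x _ => ?_
  rw [coeff_map, coeff_coeffwise, ← Algebra.smul_def, map_smul, smul_eq_mul]

theorem coeffwise_map {σ A : Type*} [CommRing A] [Algebra ℂ A] (E : A →ₗ[ℂ] ℂ) (τ : A →ₐ[ℂ] A)
    (h : ∀ f, E (τ f) = E f) (P : MvPolynomial σ A) :
    coeffwise E (map (τ : A →+* A) P) = coeffwise E P := by
  ext κ
  rw [coeff_coeffwise, coeff_map, coeff_coeffwise]
  exact h _

theorem eval_coeffwise {σ A : Type*} [Fintype σ] [CommRing A] [Algebra ℂ A] (E : A →ₗ[ℂ] ℂ)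
    (P : MvPolynomial σ A) (x : σ → ℂ) :
    eval x (coeffwise E P) = E (eval (fun i => algebraMap ℂ A (x i)) P) := by
  induction P using MvPolynomial.induction_on' with
  | monomial κ c =>
    have : coeffwise E (monomial κ c) = monomial κ (E c) := by
      classical
      ext κ'
      rw [coeff_coeffwise, coeff_monomial, coeff_monomial]
      split_ifs <;> simp
    rw [this, eval_monomial, eval_monomial, Finsupp.prod, Finsupp.prod]
    simp only [← map_pow, ← map_prod]
    rw [mul_comm c, ← Algebra.smul_def, map_smul, smul_eq_mul, mul_comm]
  | add P Q hP hQ => rw [map_add, map_add, map_add, map_add, hP, hQ]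

/-- The Euler operator `X i * ∂/∂(X i)`. -/
noncomputable def theta {σ A : Type*} [CommRing A] (i : σ) :
    Derivation A (MvPolynomial σ A) (MvPolynomial σ A) :=
  (X i : MvPolynomial σ A) • pderiv i

theorem theta_apply {σ A : Type*} [CommRing A] (i : σ) (P : MvPolynomial σ A) :
    theta i P = X i * pderiv i P := rfl

theorem coeff_theta {σ A : Type*} [CommRing A] (i : σ) (P : MvPolynomial σ A) (κ : σ →₀ ℕ) :
    (theta i P).coeff κ = κ i * P.coeff κ := by
  classical
  induction P using MvPolynomial.induction_on' with
  | monomial m c =>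
    rw [theta_apply, X_mul_pderiv_monomial, coeff_smul, coeff_monomial]
    split_ifs with h
    · subst h; simp
    · simp
  | add P Q hP hQ => rw [map_add, coeff_add, coeff_add, hP, hQ, mul_add]

theorem coeffwise_theta {σ A : Type*} [CommRing A] [Algebra ℂ A] (E : A →ₗ[ℂ] ℂ) (i : σ)
    (P : MvPolynomial σ A) : coeffwise E (theta i P) = theta i (coeffwise E P) := by
  ext κ
  rw [coeff_coeffwise, coeff_theta, coeff_theta, coeff_coeffwise, ← nsmul_eq_mul, map_nsmul,
    nsmul_eq_mul]

end Coefficientwise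

/-! ### Loop equations from rank one perturbations -/

section LoopEquations

open Matrix MvPolynomial

variable {N n : ℕ}

/-- The tautological matrix `U` over the ring `UFun N [x_0, …, x_{n-1}]`. -/
noncomputable def liftU (N n : ℕ) : Matrix (Fin N) (Fin N) (MvPolynomial (Fin n) (UFun N)) :=
  (genericU N).map C

/-- The characteristic polynomial `det (x_r - U)`. -/
noncomputable def charFactor (N : ℕ) {n : ℕ} (r : Fin n) : MvPolynomial (Fin n) (UFun N) :=
  (scalar (Fin N) (X r) - liftU N n).det

/-- The matrix `U adj (x_r - U)`. -/
noncomputable def adjResolvent (N : ℕ) {n : ℕ} (r : Fin n) :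
    Matrix (Fin N) (Fin N) (MvPolynomial (Fin n) (UFun N)) :=
  liftU N n * (scalar (Fin N) (X r) - liftU N n).adjugate

/-- The sesquilinear form `v* U adj (x_r - U) v`. -/
noncomputable def rankOneForm (N : ℕ) {n : ℕ} (r : Fin n) (v : Fin N → ℂ) :
    MvPolynomial (Fin n) (UFun N) :=
  (fun i => algebraMap ℂ (MvPolynomial (Fin n) (UFun N)) (star (v i))) ⬝ᵥ
    (adjResolvent N r *ᵥ fun i => algebraMap ℂ (MvPolynomial (Fin n) (UFun N)) (v i))

/-- The polynomial `𝔼 [∏ r, det (x_r - U) * (det U) ^ (-m)]` in `x_0, …, x_{n-1}`. -/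
noncomputable def charMoment (N n m : ℕ) : MvPolynomial (Fin n) ℂ :=
  coeffwise (haarMean N) ((∏ r, charFactor N r) * C (invDet N ^ m))

theorem liftU_map_leftTranslate (V : Matrix.unitaryGroup (Fin N) ℂ) :
    (map (leftTranslate V : UFun N →+* UFun N)).mapMatrix (liftU N n) =
      (V : Matrix (Fin N) (Fin N) ℂ).map (algebraMap ℂ _) * liftU N n := by
  have h := congrArg (fun M => (C : UFun N →+* MvPolynomial (Fin n) (UFun N)).mapMatrix M)
    (leftTranslate_genericU V)
  simp only [map_mul] at h
  refine Eq.trans ?_ (h.trans ?_)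
  · ext1 i j
    simp only [liftU, RingHom.mapMatrix_apply, map_apply, map_C]
    rfl
  · rfl

/-- Under left translation by `1 + t v v*`, each factor `det (x_r - U)` is affine in `t`. -/
theorem charFactor_map_leftTranslate (V : Matrix.unitaryGroup (Fin N) ℂ) (v : Fin N → ℂ) (t : ℂ)
    (hV : (V : Matrix (Fin N) (Fin N) ℂ) = 1 + t • vecMulVec v (star v)) (r : Fin n) :
    map (leftTranslate V : UFun N →+* UFun N) (charFactor N r) = charFactor N r -
      algebraMap ℂ (MvPolynomial (Fin n) (UFun N)) t * rankOneForm N r v := by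
  set v' : Fin N → MvPolynomial (Fin n) (UFun N) := fun i => algebraMap ℂ _ (v i)
  set w' : Fin N → MvPolynomial (Fin n) (UFun N) := fun i => algebraMap ℂ _ (star (v i))
  have hV' : (V : Matrix (Fin N) (Fin N) ℂ).map (algebraMap ℂ (MvPolynomial (Fin n) (UFun N))) =
      1 + algebraMap ℂ (MvPolynomial (Fin n) (UFun N)) t • vecMulVec v' w' := by
    rw [hV]
    ext1 i j
    by_cases h : i = j
    · subst h
      simp only [map_apply, Matrix.add_apply, one_apply_eq, Matrix.smul_apply, vecMulVec_apply,
        smul_eq_mul, map_add, map_mul, map_one, Pi.star_apply, v', w']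
    · simp only [map_apply, Matrix.add_apply, one_apply_ne h, Matrix.smul_apply, vecMulVec_apply,
        smul_eq_mul, map_add, map_mul, map_zero, Pi.star_apply, v', w']
  rw [charFactor, RingHom.map_det, map_sub, liftU_map_leftTranslate, hV']
  have hs : (map (leftTranslate V : UFun N →+* UFun N)).mapMatrix
      (scalar (Fin N) (X r : MvPolynomial (Fin n) (UFun N))) = scalar (Fin N) (X r) := by
    ext1 i j
    by_cases h : i = j
    · subst h; simp
    · simp [h]
  rw [hs]
  have : scalar (Fin N) (X r) - (1 + algebraMap ℂ (MvPolynomial (Fin n) (UFun N)) t •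
      vecMulVec v' w') * liftU N n = (scalar (Fin N) (X r) - liftU N n) +
        vecMulVec (-(algebraMap ℂ (MvPolynomial (Fin n) (UFun N)) t) • v') (w' ᵥ* liftU N n) := by
    rw [add_mul, one_mul, smul_mul_assoc, vecMulVec_mul, smul_vecMulVec]
    module
  rw [this, det_add_vecMulVec, mulVec_smul, dotProduct_smul, ← dotProduct_mulVec, mulVec_mulVec,
    smul_eq_mul, rankOneForm, adjResolvent]
  ring

open scoped ComplexOrder in
/-- The rank one perturbation `1 + t v v*` of the identity is unitary if `|1 + t |v|²| = 1`. -/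
theorem one_add_smul_vecMulVec_mem (v : Fin N → ℂ) (t : ℂ) (ht : ‖1 + t * (star v ⬝ᵥ v)‖ = 1) :
    1 + t • vecMulVec v (star v) ∈ Matrix.unitaryGroup (Fin N) ℂ := by
  set s := star v ⬝ᵥ v with hs
  have hsr : star s = s := by
    rw [hs, ← star_dotProduct_star, star_star, dotProduct_comm]
  have h1 : (1 + t * s) * (1 + star t * s) = 1 := by
    have := Complex.mul_conj (1 + t * s)
    rw [Complex.normSq_eq_norm_sq, ht] at this
    rw [← Complex.star_def, star_add, star_mul', star_one, hsr] at this
    rw [this]; norm_num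
  rw [mem_unitaryGroup_iff, star_eq_conjTranspose, conjTranspose_add, conjTranspose_one,
    conjTranspose_smul]
  have h2 : (vecMulVec v (star v))ᴴ = vecMulVec v (star v) := by
    simp [conjTranspose_vecMulVec]
  have h3 : vecMulVec v (star v) * vecMulVec v (star v) = s • vecMulVec v (star v) := by
    rw [vecMulVec_mul_vecMulVec, vecMulVec_smul]
  rw [h2, add_mul, mul_add, mul_add, smul_mul_smul_comm, h3]
  by_cases h0 : s = 0
  · have : v = 0 := dotProduct_star_self_eq_zero.mp (hs.symm.trans h0)
    simp [this]
  · have : t + star t + t * star t * s = 0 := by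
      apply mul_right_cancel₀ h0
      linear_combination h1
    calc _ = 1 + (t + star t + t * star t * s) • vecMulVec v (star v) := by
          simp only [one_mul, mul_one]; module
      _ = 1 := by rw [this, zero_smul, add_zero]

/-- The fundamental identity: invariance of Haar measure under `U ↦ (1 + t v v*) U`, expanded in
powers of `t`. -/
theorem coeffwise_coeff_rank_one (m : ℕ) (v : Fin N → ℂ) (d : ℕ) :
    coeffwise (haarMean N) ((∏ r : Fin n, (Polynomial.C (charFactor N r) - Polynomial.X *
      Polynomial.C (rankOneForm N r v))).coeff d * C (invDet N ^ m)) =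
      algebraMap ℂ _ ((m.choose d : ℂ) * (star v ⬝ᵥ v) ^ d) * charMoment N n m := by
  set s := star v ⬝ᵥ v with hs
  set P := ∏ r : Fin n, (Polynomial.C (charFactor N r) - Polynomial.X *
      Polynomial.C (rankOneForm N r v)) with hP
  have hinf : {t : ℂ | ‖1 + t * s‖ = 1}.Infinite := by
    by_cases h0 : s = 0
    · simpa [h0] using Set.infinite_univ (α := ℂ)
    · refine (infinite_norm_eq_one.image (f := fun w => (w - 1) / s) ?_).mono ?_
      · intro a _ b _ h
        have := (div_left_inj' h0).mp h
        simpa using this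
      · rintro _ ⟨w, hw, rfl⟩
        simpa [h0] using hw
  have key := map_coeff_eq_of_infinite (coeffwise (haarMean N))
    (P * Polynomial.C (C (invDet N ^ m)))
    (Polynomial.C (charMoment N n m) * (1 + Polynomial.C (algebraMap ℂ _ s) * Polynomial.X) ^ m)
    hinf ?_ d
  · rw [Polynomial.coeff_mul_C] at key
    have hcomp : (1 + Polynomial.C (algebraMap ℂ (MvPolynomial (Fin n) ℂ) s) * Polynomial.X) ^ m =
        ((1 + Polynomial.X) ^ m).comp
          (Polynomial.C (algebraMap ℂ (MvPolynomial (Fin n) ℂ) s) * Polynomial.X) := by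
      simp
    rw [key, Polynomial.coeff_C_mul, hcomp, Polynomial.comp_C_mul_X_coeff,
      Polynomial.coeff_one_add_X_pow, mul_comm, map_mul, map_pow, map_natCast]
  · intro t ht
    set V : Matrix.unitaryGroup (Fin N) ℂ := ⟨_, one_add_smul_vecMulVec_mem v t ht⟩ with hV
    have hdet : (V : Matrix (Fin N) (Fin N) ℂ).det = 1 + t * s := by
      rw [hV]
      simp only
      rw [← smul_vecMulVec, det_add_vecMulVec]
      simp [hs]
    have h1 := coeffwise_map (haarMean N) (leftTranslate V) (haarMean_leftTranslate V)
      ((∏ r : Fin n, charFactor N r) * C (invDet N ^ m))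
    rw [map_mul, map_prod, map_C] at h1
    simp only [charFactor_map_leftTranslate V v t rfl] at h1
    have hu : star (1 + t * s) * (1 + t * s) = 1 := by
      rw [← hdet]; exact Unitary.star_mul_self_of_mem (det_of_mem_unitary V.2)
    have h2 : C (((leftTranslate V : UFun N →+* UFun N)) (invDet N ^ m)) =
        algebraMap ℂ (MvPolynomial (Fin n) (UFun N)) (star (1 + t * s) ^ m) *
          C (invDet N ^ m) := by
      rw [RingHom.coe_coe, map_pow, leftTranslate_invDet, hdet, mul_pow, C_mul, ← map_pow]
      rfl
    rw [← charMoment, h2, mul_left_comm, ← Algebra.smul_def, map_smul] at h1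
    have h3 : Polynomial.eval (algebraMap ℂ _ t) (P * Polynomial.C (C (invDet N ^ m))) =
        (∏ r : Fin n, (charFactor N r - algebraMap ℂ _ t * rankOneForm N r v)) *
          C (invDet N ^ m) := by
      simp only [hP, Polynomial.eval_mul, Polynomial.eval_prod, Polynomial.eval_sub,
        Polynomial.eval_C, Polynomial.eval_X]
    rw [h3, ← h1, Polynomial.eval_mul, Polynomial.eval_C, Polynomial.eval_pow]
    simp only [Polynomial.eval_add, Polynomial.eval_one, Polynomial.eval_mul, Polynomial.eval_C,
      Polynomial.eval_X]
    rw [← map_one (algebraMap ℂ (MvPolynomial (Fin n) ℂ)), ← map_mul, ← map_add, ← map_pow,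
      mul_comm _ (algebraMap _ _ _), ← Algebra.smul_def, smul_smul, ← mul_pow, mul_comm _ (star _),
      mul_comm s t, hu,
      one_pow, one_smul]

theorem rankOneForm_single (r : Fin n) (i : Fin N) :
    rankOneForm N r (Pi.single i 1) = adjResolvent N r i i := by
  have h1 : (fun a => algebraMap ℂ (MvPolynomial (Fin n) (UFun N)) (Pi.single (M := fun _ => ℂ) i 1 a)) =
      Pi.single i 1 := by
    ext1 a
    by_cases h : a = i
    · subst h; simp only [Pi.single_eq_same, map_one]
    · simp only [Pi.single_eq_of_ne h, map_zero]
  have h2 : (fun a => algebraMap ℂ (MvPolynomial (Fin n) (UFun N))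
      (star (Pi.single (M := fun _ => ℂ) i 1 a))) = Pi.single i 1 := by
    ext1 a
    by_cases h : a = i
    · subst h; simp only [Pi.single_eq_same, star_one, map_one]
    · simp only [Pi.single_eq_of_ne h, star_zero, map_zero]
  rw [rankOneForm, h1, h2, single_dotProduct, one_mul, mulVec_single_one]
  rfl

theorem rankOneForm_add (r : Fin n) (i j : Fin N) (ω : ℂ) (hω : ω * star ω = 1) :
    rankOneForm N r (Pi.single i 1 + ω • Pi.single j 1) =
      adjResolvent N r i i + adjResolvent N r j j
        + algebraMap ℂ (MvPolynomial (Fin n) (UFun N)) ω * adjResolvent N r i j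
        + algebraMap ℂ (MvPolynomial (Fin n) (UFun N)) (star ω) * adjResolvent N r j i := by
  have h0 : ∀ i a : Fin N, algebraMap ℂ (MvPolynomial (Fin n) (UFun N))
      (Pi.single (M := fun _ => ℂ) i 1 a) = Pi.single (M := fun _ => _) i 1 a := by
    intro i a
    by_cases h : a = i
    · subst h; simp only [Pi.single_eq_same, map_one]
    · simp only [Pi.single_eq_of_ne h, map_zero]
  have h1 : (fun a => algebraMap ℂ (MvPolynomial (Fin n) (UFun N))
      ((Pi.single i 1 + ω • Pi.single j 1 : Fin N → ℂ) a)) =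
      Pi.single i 1 + algebraMap ℂ (MvPolynomial (Fin n) (UFun N)) ω • Pi.single j 1 := by
    ext1 a
    simp only [Pi.add_apply, Pi.smul_apply, smul_eq_mul, map_add, map_mul, h0]
  have h2 : (fun a => algebraMap ℂ (MvPolynomial (Fin n) (UFun N))
      (star ((Pi.single i 1 + ω • Pi.single j 1 : Fin N → ℂ) a))) =
      Pi.single i 1 + algebraMap ℂ (MvPolynomial (Fin n) (UFun N)) (star ω) • Pi.single j 1 := by
    ext1 a
    have hs : ∀ i, star (Pi.single (M := fun _ => ℂ) i 1 a) = Pi.single (M := fun _ => ℂ) i 1 a := by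
      intro i
      by_cases h : a = i
      · subst h; simp only [Pi.single_eq_same, star_one]
      · simp only [Pi.single_eq_of_ne h, star_zero]
    simp only [Pi.add_apply, Pi.smul_apply, smul_eq_mul, map_add, map_mul, h0, star_add, star_mul',
      hs]
  have h3 : algebraMap ℂ (MvPolynomial (Fin n) (UFun N)) ω *
      algebraMap ℂ (MvPolynomial (Fin n) (UFun N)) (star ω) = 1 := by
    rw [← map_mul, hω, map_one]
  rw [rankOneForm, h1, h2]
  simp only [add_dotProduct, smul_dotProduct, single_dotProduct, one_mul, mulVec_add, mulVec_smul,
    mulVec_single_one, Pi.add_apply, Pi.smul_apply, smul_eq_mul, col_apply]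
  linear_combination adjResolvent N r j j * h3

theorem star_dotProduct_add_smul_single (i j : Fin N) (ω : ℂ) (hω : ω * star ω = 1) :
    star (Pi.single i 1 + ω • Pi.single j 1 : Fin N → ℂ) ⬝ᵥ (Pi.single i 1 + ω • Pi.single j 1) =
      2 + (ω + star ω) * (if i = j then 1 else 0) := by
  rw [star_add, star_smul]
  have hs : ∀ i : Fin N, star (Pi.single i 1 : Fin N → ℂ) = Pi.single i 1 := by
    intro i; rw [← Pi.single_star, star_one]
  simp only [hs, add_dotProduct, smul_dotProduct, single_dotProduct, one_mul, Pi.add_apply,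
    Pi.smul_apply, smul_eq_mul, Pi.single_apply]
  by_cases h : i = j
  · subst h; simp only [if_true]; linear_combination hω
  · simp only [h, Ne.symm h, if_true, if_false]; linear_combination hω

/-- Stated over an abstract ring, as are `map_ofNat_mul_eq`, `map_natCast_mul_eq`, `map_add_mul_eq`
and `map_sub_mul_eq`, because rewriting with ring lemmas inside `MvPolynomial (Fin n) (UFun N)` meets
instances that are not reducibly equal. -/
theorem map_neg_mul_eq {A R : Type*} [CommRing A] [Algebra ℂ A] [AddCommGroup R] [Module ℂ R]
    (E : A →ₗ[ℂ] R) (a b : A) : E (-a * b) = -E (a * b) := by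
  rw [neg_mul, map_neg]

/-- The trace identity from the first order in `t`. -/
theorem coeffwise_sum_trace (m : ℕ) :
    coeffwise (haarMean N) ((∑ r : Fin n, (adjResolvent N r).trace *
      ∏ r' ∈ Finset.univ.erase r, charFactor N r') * C (invDet N ^ m)) =
      -algebraMap ℂ _ ((m : ℂ) * N) * charMoment N n m := by
  have h : ∀ i : Fin N, coeffwise (haarMean N) ((∑ r : Fin n, adjResolvent N r i i *
      ∏ r' ∈ Finset.univ.erase r, charFactor N r') * C (invDet N ^ m)) =
      -algebraMap ℂ _ (m : ℂ) * charMoment N n m := by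
    intro i
    have := coeffwise_coeff_rank_one (n := n) m (Pi.single i 1) 1
    have hs : star (Pi.single i 1 : Fin N → ℂ) ⬝ᵥ Pi.single i 1 = 1 := by
      rw [← Pi.single_star, star_one, single_dotProduct, one_mul, Pi.single_eq_same]
    simp only [coeff_one_prod_sub, rankOneForm_single, hs, Nat.choose_one_right, one_pow,
      mul_one] at this
    rw [neg_mul, ← this, map_neg_mul_eq, neg_neg]
  have h' := Finset.sum_congr (s₁ := Finset.univ) rfl fun i _ => h i
  rw [← map_sum, ← Finset.sum_mul, Finset.sum_comm] at h'
  simp only [← Finset.sum_mul] at h'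
  rw [Finset.sum_const, Finset.card_univ, Fintype.card_fin] at h'
  refine h'.trans ?_
  rw [map_mul, map_natCast, map_natCast, nsmul_eq_mul]
  ring

theorem coeffwise_sum_rankOneForm_mul (m : ℕ) (v : Fin N → ℂ) :
    coeffwise (haarMean N) ((∑ r : Fin n, ∑ r' ∈ Finset.univ.erase r,
      rankOneForm N r v * rankOneForm N r' v *
      ∏ r'' ∈ (Finset.univ.erase r).erase r', charFactor N r'') * C (invDet N ^ m)) =
      algebraMap ℂ _ ((m : ℂ) * (m - 1) * (star v ⬝ᵥ v) ^ 2) * charMoment N n m := by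
  have hc : (m : ℂ) * (m - 1) = 2 * (m.choose 2 : ℂ) := by
    rw [Nat.cast_choose_two]; ring
  rw [← two_mul_coeff_two_prod_sub, mul_assoc, two_mul, map_add, coeffwise_coeff_rank_one, hc,
    mul_assoc, map_mul _ 2, map_ofNat]
  ring

theorem map_ofNat_mul_eq {A R : Type*} [CommRing A] [Algebra ℂ A] [CommRing R] [Algebra ℂ R]
    (E : A →ₗ[ℂ] R) (k : ℕ) [k.AtLeastTwo] (a : A) :
    E (OfNat.ofNat k * a) = OfNat.ofNat k * E a := by
  rw [← Nat.cast_ofNat, ← Nat.cast_ofNat (R := R), ← nsmul_eq_mul, map_nsmul, nsmul_eq_mul]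

/-- Polarisation over the fourth roots of unity `1, -1, J, -J`. -/
theorem polarization_sum {A : Type*} [CommRing A] {ι : Type*} (s : Finset ι) (s' : ι → Finset ι)
    (a a' b c : ι → A) (w : ι → ι → A) {J : A} (hJ : J ^ 2 = -1) :
    ∑ r ∈ s, ∑ r' ∈ s' r, (a r + a' r + 1 * b r + 1 * c r) * (a r' + a' r' + 1 * b r' + 1 * c r') *
        w r r'
      + ∑ r ∈ s, ∑ r' ∈ s' r, (a r + a' r + -1 * b r + -1 * c r) *
        (a r' + a' r' + -1 * b r' + -1 * c r') * w r r'
      + ∑ r ∈ s, ∑ r' ∈ s' r, (a r + a' r + J * b r + -J * c r) *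
        (a r' + a' r' + J * b r' + -J * c r') * w r r'
      + ∑ r ∈ s, ∑ r' ∈ s' r, (a r + a' r + -J * b r + - -J * c r) *
        (a r' + a' r' + -J * b r' + - -J * c r') * w r r' =
    4 * ∑ r ∈ s, ∑ r' ∈ s' r, ((a r + a' r) * (a r' + a' r') + b r * c r' + c r * b r') *
      w r r' := by
  simp only [Finset.mul_sum, ← Finset.sum_add_distrib]
  refine Finset.sum_congr rfl fun r _ => Finset.sum_congr rfl fun r' _ => ?_
  linear_combination (2 * (b r - c r) * (b r' - c r') * w r r') * hJ

theorem map_natCast_mul_eq {A R : Type*} [CommRing A] [Algebra ℂ A] [CommRing R] [Algebra ℂ R]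
    (E : A →ₗ[ℂ] R) (k : ℕ) (a : A) : E (k * a) = k * E a := by
  rw [← nsmul_eq_mul, map_nsmul, nsmul_eq_mul]

theorem map_add_mul_eq {A R : Type*} [CommRing A] [Algebra ℂ A] [AddCommGroup R] [Module ℂ R]
    (E : A →ₗ[ℂ] R) (a b c : A) : E ((a + b) * c) = E (a * c) + E (b * c) := by
  rw [add_mul, map_add]

theorem sum_sum_polarization {A : Type*} [CommRing A] {ι : Type*} (s : Finset ι)
    (s' : ι → Finset ι) (M : ι → Matrix (Fin N) (Fin N) A) (w : ι → ι → A) :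
    ∑ i, ∑ j, ∑ r ∈ s, ∑ r' ∈ s' r, ((M r i i + M r j j) * (M r' i i + M r' j j)
      + M r i j * M r' j i + M r j i * M r' i j) * w r r' =
    2 * (N * ∑ i, ∑ r ∈ s, ∑ r' ∈ s' r, M r i i * M r' i i * w r r') +
      2 * ∑ r ∈ s, ∑ r' ∈ s' r, ((M r).trace * (M r').trace + (M r * M r').trace) * w r r' := by
  have h1 : ∀ r r', ∑ i, ∑ j, ((M r i i + M r j j) * (M r' i i + M r' j j)
      + M r i j * M r' j i + M r j i * M r' i j) =
      2 * (N * ∑ i, M r i i * M r' i i) +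
        2 * ((M r).trace * (M r').trace + (M r * M r').trace) := by
    intro r r'
    have e : ∀ i j, (M r i i + M r j j) * (M r' i i + M r' j j)
      + M r i j * M r' j i + M r j i * M r' i j = M r i i * M r' i i + M r j j * M r' j j +
        (M r i i * M r' j j + M r i j * M r' j i) + (M r j j * M r' i i + M r j i * M r' i j) := by
      intro i j; ring
    have t1 : ∑ i, ∑ j, (M r i i * M r' j j + M r i j * M r' j i) =
        (M r).trace * (M r').trace + (M r * M r').trace := by
      simp only [trace, diag_apply, mul_apply, Finset.sum_mul_sum, Finset.sum_add_distrib]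
    have t2 : ∑ i, ∑ j, (M r j j * M r' i i + M r j i * M r' i j) =
        (M r).trace * (M r').trace + (M r * M r').trace := by
      rw [← t1, Finset.sum_comm]
    simp only [e]
    simp only [Finset.sum_add_distrib] at t1 t2 ⊢
    simp only [Finset.sum_const, Finset.card_univ, Fintype.card_fin, nsmul_eq_mul,
      ← Finset.mul_sum]
    simp only [← Finset.mul_sum] at t1 t2
    linear_combination t1 + t2
  calc _ = ∑ i, ∑ r ∈ s, ∑ r' ∈ s' r, ∑ j, ((M r i i + M r j j) * (M r' i i + M r' j j)
      + M r i j * M r' j i + M r j i * M r' i j) * w r r' := by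
        refine Finset.sum_congr rfl fun i _ => ?_
        rw [Finset.sum_comm]
        exact Finset.sum_congr rfl fun r _ => Finset.sum_comm
    _ = ∑ r ∈ s, ∑ r' ∈ s' r, (∑ i, ∑ j, ((M r i i + M r j j) * (M r' i i + M r' j j)
      + M r i j * M r' j i + M r j i * M r' i j)) * w r r' := by
        rw [Finset.sum_comm]
        refine Finset.sum_congr rfl fun r _ => ?_
        rw [Finset.sum_comm]
        simp only [Finset.sum_mul]
    _ = _ := by
        have c : ∑ i, ∑ r ∈ s, ∑ r' ∈ s' r, M r i i * M r' i i * w r r' =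
            ∑ r ∈ s, ∑ r' ∈ s' r, (∑ i, M r i i * M r' i i) * w r r' := by
          rw [Finset.sum_comm]
          refine Finset.sum_congr rfl fun r _ => ?_
          rw [Finset.sum_comm]
          simp only [Finset.sum_mul]
        rw [c]
        obtain ⟨t, ht⟩ : ∃ t : ι → ι → A, ∀ r r', ∑ i, M r i i * M r' i i = t r r' :=
          ⟨_, fun _ _ => rfl⟩
        simp only [h1, ht, Finset.mul_sum, ← Finset.sum_add_distrib]
        exact Finset.sum_congr rfl fun r _ => Finset.sum_congr rfl fun r' _ => by ring

/-- The quadratic trace identity, from the second order in `t` by polarisation: `v` runs through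
the vectors `e_i` and `e_i + ω e_j` with `ω ^ 4 = 1`. -/
theorem coeffwise_sum_trace_mul_trace (m : ℕ) :
    coeffwise (haarMean N) ((∑ r : Fin n, ∑ r' ∈ Finset.univ.erase r,
      ((adjResolvent N r).trace * (adjResolvent N r').trace
        + (adjResolvent N r * adjResolvent N r').trace) *
      ∏ r'' ∈ (Finset.univ.erase r).erase r', charFactor N r'') * C (invDet N ^ m)) =
      algebraMap ℂ _ ((N : ℂ) * (N + 1) * (m * (m - 1))) * charMoment N n m := by
  have hdiag : ∀ i : Fin N, coeffwise (haarMean N) ((∑ r : Fin n, ∑ r' ∈ Finset.univ.erase r,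
      adjResolvent N r i i * adjResolvent N r' i i *
      ∏ r'' ∈ (Finset.univ.erase r).erase r', charFactor N r'') * C (invDet N ^ m)) =
      algebraMap ℂ _ ((m : ℂ) * (m - 1)) * charMoment N n m := by
    intro i
    have := coeffwise_sum_rankOneForm_mul (n := n) m (Pi.single i 1)
    have hs : star (Pi.single i 1 : Fin N → ℂ) ⬝ᵥ Pi.single i 1 = 1 := by
      rw [← Pi.single_star, star_one, single_dotProduct, one_mul, Pi.single_eq_same]
    simpa only [rankOneForm_single, hs, one_pow, mul_one] using this
  have hpair : ∀ i j : Fin N, coeffwise (haarMean N) ((∑ r : Fin n, ∑ r' ∈ Finset.univ.erase r,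
      ((adjResolvent N r i i + adjResolvent N r j j) *
        (adjResolvent N r' i i + adjResolvent N r' j j) + adjResolvent N r i j *
        adjResolvent N r' j i + adjResolvent N r j i * adjResolvent N r' i j) *
      ∏ r'' ∈ (Finset.univ.erase r).erase r', charFactor N r'') * C (invDet N ^ m)) =
      algebraMap ℂ _ ((m : ℂ) * (m - 1) * (4 + 2 * if i = j then 1 else 0)) *
        charMoment N n m := by
    intro i j
    have hI : (algebraMap ℂ (MvPolynomial (Fin n) (UFun N)) Complex.I) ^ 2 = -1 := by
      rw [← map_pow, Complex.I_sq, map_neg, map_one]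
    have h := fun (ω : ℂ) (hω : ω * star ω = 1) => by
      have := coeffwise_sum_rankOneForm_mul (n := n) m (Pi.single i 1 + ω • Pi.single j 1)
      simp only [rankOneForm_add _ i j ω hω, star_dotProduct_add_smul_single i j ω hω] at this
      exact this
    have e1 := h 1 (by simp)
    have e2 := h (-1) (by simp)
    have e3 := h Complex.I (by simp)
    have e4 := h (-Complex.I) (by simp)
    simp only [star_one, star_neg, Complex.star_def, Complex.conj_I, map_neg, map_one] at e1 e2 e3 e4
    have hd : ((if i = j then 1 else 0 : ℂ)) ^ 2 = if i = j then 1 else 0 := by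
      split_ifs <;> simp
    have hR : (m : ℂ) * (m - 1) * (2 + (1 + 1) * if i = j then 1 else 0) ^ 2
        + m * (m - 1) * (2 + (-1 + -1) * if i = j then 1 else 0) ^ 2
        + m * (m - 1) * (2 + (Complex.I + -Complex.I) * if i = j then 1 else 0) ^ 2
        + m * (m - 1) * (2 + (-Complex.I + - -Complex.I) * if i = j then 1 else 0) ^ 2
        = 4 * (m * (m - 1) * (4 + 2 * if i = j then 1 else 0)) := by
      linear_combination (8 * (m : ℂ) * (m - 1)) * hd
    have e5 := congrArg₂ (· + ·) (congrArg₂ (· + ·) (congrArg₂ (· + ·) e1 e2) e3) e4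
    simp only [← add_mul, ← map_add] at e5
    rw [hR, polarization_sum _ _ _ _ _ _ _ hI, mul_assoc, map_ofNat_mul_eq, map_mul _ 4, map_ofNat,
      mul_assoc] at e5
    exact mul_left_cancel₀ (by norm_num) e5
  have hsum := Finset.sum_congr (s₁ := Finset.univ) rfl fun i _ =>
    Finset.sum_congr (s₁ := Finset.univ) rfl fun j _ => hpair i j
  have hdsum := Finset.sum_congr (s₁ := Finset.univ) rfl fun i _ => hdiag i
  simp only [← map_sum, ← Finset.sum_mul] at hsum hdsum
  have hcount : ∑ i : Fin N, ∑ j : Fin N, (m : ℂ) * (m - 1) * (4 + 2 * if i = j then 1 else 0) =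
      m * (m - 1) * (4 * N ^ 2 + 2 * N) := by
    simp only [← Finset.mul_sum, Finset.sum_add_distrib, Finset.sum_ite_eq, Finset.mem_univ,
      if_true, Finset.sum_const, Finset.card_univ, Fintype.card_fin, nsmul_eq_mul]
    ring
  rw [hcount, sum_sum_polarization, map_add_mul_eq, mul_assoc, mul_assoc, mul_assoc,
    map_ofNat_mul_eq, map_ofNat_mul_eq, map_natCast_mul_eq, hdsum] at hsum
  simp only [Finset.sum_const, Finset.card_univ, Fintype.card_fin, nsmul_eq_mul] at hsum
  refine mul_left_cancel₀ (b := _) (two_ne_zero (α := MvPolynomial (Fin n) ℂ)) ?_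
  have h2 := eq_sub_of_add_eq' hsum
  rw [h2]
  simp only [map_mul, map_add, map_sub, map_pow, map_natCast, map_ofNat, map_one]
  ring

end LoopEquations

/-! ### The Vandermonde product under Euler operators -/

section Vandermonde

open Matrix MvPolynomial

variable {n : ℕ} {A : Type*} [CommRing A]

theorem Derivation.map_prod_eq_sum {R B ι : Type*} [CommRing R] [CommRing B] [Algebra R B]
    [DecidableEq ι] (D : Derivation R B B) (s : Finset ι) (f : ι → B) :
    D (∏ i ∈ s, f i) = ∑ i ∈ s, (∏ j ∈ s.erase i, f j) * D (f i) := by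
  induction s using Finset.induction_on with
  | empty => simp
  | insert a s ha ih =>
    rw [Finset.prod_insert ha, D.leibniz, ih, Finset.sum_insert ha, Finset.erase_insert ha,
      smul_eq_mul, smul_eq_mul, Finset.mul_sum, add_comm]
    congr 1
    refine Finset.sum_congr rfl fun i hi => ?_
    have hne : a ≠ i := fun h => ha (h ▸ hi)
    rw [Finset.erase_insert_of_ne hne, Finset.prod_insert (fun h => ha (Finset.mem_of_mem_erase h)),
      mul_assoc]

theorem theta_X (r s : Fin n) :
    theta r (X s : MvPolynomial (Fin n) A) = if r = s then X s else 0 := by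
  rw [theta_apply, pderiv_X, Pi.single_apply]
  by_cases h : r = s
  · subst h; simp
  · simp [h, Ne.symm h]

/-- The Vandermonde product `∏_{i < j} (x_j - x_i)` of the variables. -/
noncomputable def vdm (n : ℕ) (A : Type*) [CommRing A] : MvPolynomial (Fin n) A :=
  (vandermonde fun i : Fin n => (X i : MvPolynomial (Fin n) A)).det

theorem vdm_ne_zero [IsDomain A] : vdm n A ≠ 0 :=
  det_vandermonde_ne_zero_iff.mpr (X_injective)

theorem map_vdm {B : Type*} [CommRing B] (φ : A →+* B) : map φ (vdm n A) = vdm n B := by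
  rw [vdm, vdm, RingHom.map_det]
  congr 1
  ext1 i j
  simp [vandermonde_apply]

/-- The pairs `(i, j)` with `i < j`. -/
def ltPairs (n : ℕ) : Finset (Fin n × Fin n) := Finset.univ.filter fun p => p.1 < p.2

theorem vdm_eq_prod : vdm n A = ∏ p ∈ ltPairs n, (X p.2 - X p.1) := by
  rw [vdm, det_vandermonde, ltPairs, Finset.prod_filter, Fintype.prod_prod_type]
  refine Finset.prod_congr rfl fun i _ => ?_
  rw [← Finset.prod_filter]
  congr 1
  ext j; simp

/-- The logarithmic derivatives of the Vandermonde product, grouped by pairs of variables. -/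
theorem sum_theta_vdm_mul (g : Fin n → MvPolynomial (Fin n) A) :
    ∑ r, theta r (vdm n A) * g r = ∑ p ∈ ltPairs n,
      (∏ q ∈ (ltPairs n).erase p, (X q.2 - X q.1)) * (X p.2 * g p.2 - X p.1 * g p.1) := by
  have h : ∀ r, theta r (vdm n A) * g r = ∑ p ∈ ltPairs n,
      (∏ q ∈ (ltPairs n).erase p, (X q.2 - X q.1)) *
        ((if r = p.2 then X p.2 * g p.2 else 0) - (if r = p.1 then X p.1 * g p.1 else 0)) := by
    intro r
    rw [vdm_eq_prod, Derivation.map_prod_eq_sum, Finset.sum_mul]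
    refine Finset.sum_congr rfl fun p _ => ?_
    rw [map_sub, theta_X, theta_X, mul_assoc, sub_mul]
    congr 2
    · split_ifs with h
      · rw [h]
      · rw [zero_mul]
    · split_ifs with h
      · rw [h]
      · rw [zero_mul]
  simp only [h]
  rw [Finset.sum_comm]
  refine Finset.sum_congr rfl fun p _ => ?_
  rw [← Finset.mul_sum, Finset.sum_sub_distrib]
  simp

theorem sum_sum_erase_eq_two_mul (T : Fin n → Fin n → A) (hT : ∀ r s, T r s = T s r) :
    ∑ r, ∑ s ∈ Finset.univ.erase r, T r s = 2 * ∑ p ∈ ltPairs n, T p.1 p.2 := by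
  have h : ∀ r : Fin n, ∑ s ∈ Finset.univ.erase r, T r s =
      ∑ s, (if r < s then T r s else 0) + ∑ s, (if s < r then T r s else 0) := by
    intro r
    rw [← Finset.sum_add_distrib, ← Finset.sum_erase (s := Finset.univ) (a := r)]
    · refine Finset.sum_congr rfl fun s hs => ?_
      rcases lt_trichotomy r s with h | h | h
      · simp [h, h.not_gt]
      · exact absurd h.symm (Finset.ne_of_mem_erase hs)
      · simp [h, h.not_gt]
    · simp
  have h1 : ∑ p ∈ ltPairs n, T p.1 p.2 = ∑ r, ∑ s, (if r < s then T r s else 0) := by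
    rw [ltPairs, Finset.sum_filter, Fintype.sum_prod_type]
  simp only [h]
  rw [Finset.sum_add_distrib, two_mul, h1]
  congr 1
  rw [Finset.sum_comm]
  exact Finset.sum_congr rfl fun r _ => Finset.sum_congr rfl fun s _ => by rw [hT]

theorem theta_prod_X_pow (r : Fin n) (e : Fin n → ℕ) :
    theta r (∏ i, (X i : MvPolynomial (Fin n) A) ^ e i) =
      (e r : MvPolynomial (Fin n) A) * ∏ i, X i ^ e i := by
  have h : (∏ i, (X i : MvPolynomial (Fin n) A) ^ e i) =
      monomial (Finsupp.equivFunOnFinite.symm e) 1 := by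
    rw [monomial_eq, C_1, one_mul, Finsupp.prod_fintype _ _ (by simp)]
    simp
  rw [h, theta_apply, X_mul_pderiv_monomial, nsmul_eq_mul]
  simp

theorem det_X_pow_eq_sum (e : Fin n → ℕ) :
    (of fun r c : Fin n => (X r : MvPolynomial (Fin n) A) ^ e c).det =
      ∑ σ : Equiv.Perm (Fin n), Equiv.Perm.sign σ • ∏ r, X r ^ e (σ r) := by
  rw [← det_transpose, det_apply]
  rfl

theorem sum_theta_vdm :
    ∑ r, theta r (vdm n A) = ((∑ i ∈ Finset.range n, i : ℕ) : MvPolynomial (Fin n) A) * vdm n A := by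
  have hv : vdm n A = ∑ σ : Equiv.Perm (Fin n), Equiv.Perm.sign σ •
      ∏ r, (X r : MvPolynomial (Fin n) A) ^ (σ r : ℕ) := det_X_pow_eq_sum fun c => c
  rw [hv, Finset.mul_sum]
  simp only [map_sum, Units.smul_def, map_zsmul, theta_prod_X_pow]
  rw [Finset.sum_comm]
  refine Finset.sum_congr rfl fun σ _ => ?_
  rw [← Finset.smul_sum, ← Finset.sum_mul, mul_smul_comm]
  congr 2
  rw [Equiv.sum_comp σ fun i => ((i : ℕ) : MvPolynomial (Fin n) A), Finset.sum_range,
    Nat.cast_sum]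

theorem sum_theta_theta_vdm :
    ∑ r, theta r (theta r (vdm n A)) =
      ((∑ i ∈ Finset.range n, i ^ 2 : ℕ) : MvPolynomial (Fin n) A) * vdm n A := by
  have hv : vdm n A = ∑ σ : Equiv.Perm (Fin n), Equiv.Perm.sign σ •
      ∏ r, (X r : MvPolynomial (Fin n) A) ^ (σ r : ℕ) := det_X_pow_eq_sum fun c => c
  rw [hv, Finset.mul_sum]
  simp only [map_sum, Units.smul_def, map_zsmul, theta_prod_X_pow, Derivation.leibniz,
    Derivation.map_natCast, mul_zero, add_zero, smul_eq_mul]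
  rw [Finset.sum_comm]
  refine Finset.sum_congr rfl fun σ _ => ?_
  rw [← Finset.smul_sum, mul_smul_comm]
  congr 1
  simp only [← mul_assoc, ← Finset.sum_mul]
  congr 1
  rw [Equiv.sum_comp σ fun i => ((i : ℕ) : MvPolynomial (Fin n) A) * ((i : ℕ) :
    MvPolynomial (Fin n) A), Finset.sum_range, Nat.cast_sum]
  exact Finset.sum_congr rfl fun i _ => by push_cast; ring

theorem coeff_prod_aeval_X (q : Fin n → Polynomial A) (κ : Fin n →₀ ℕ) :
    (∏ r, Polynomial.aeval (X r : MvPolynomial (Fin n) A) (q r)).coeff κ =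
      ∏ r, (q r).coeff (κ r) := by
  classical
  obtain ⟨L, hL⟩ : ∃ L, (∀ r, (q r).natDegree < L) ∧ ∀ r, κ r < L :=
    ⟨Finset.univ.sup (fun r => (q r).natDegree + κ r) + 1, fun r => Nat.lt_succ_of_le
      ((Nat.le_add_right _ _).trans (Finset.le_sup (f := fun r => (q r).natDegree + κ r)
        (Finset.mem_univ r))), fun r => Nat.lt_succ_of_le
      ((Nat.le_add_left _ _).trans (Finset.le_sup (f := fun r => (q r).natDegree + κ r)
        (Finset.mem_univ r)))⟩
  have h : ∀ r, Polynomial.aeval (X r : MvPolynomial (Fin n) A) (q r) =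
      ∑ j ∈ Finset.range L, C ((q r).coeff j) * X r ^ j := by
    intro r
    rw [Polynomial.aeval_eq_sum_range' (hL.1 r)]
    exact Finset.sum_congr rfl fun j _ => by rw [smul_eq_C_mul]
  simp only [h]
  rw [Finset.prod_univ_sum, coeff_sum]
  have h2 : ∀ e : Fin n → ℕ, (∏ r, C ((q r).coeff (e r)) * (X r : MvPolynomial (Fin n) A) ^ e r).coeff κ
      = if Finsupp.equivFunOnFinite.symm e = κ then ∏ r, (q r).coeff (e r) else 0 := by
    intro e
    rw [Finset.prod_mul_distrib, ← map_prod, coeff_C_mul]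
    have h : (∏ i, (X i : MvPolynomial (Fin n) A) ^ e i) =
        monomial (Finsupp.equivFunOnFinite.symm e) 1 := by
      rw [monomial_eq, C_1, one_mul, Finsupp.prod_fintype _ _ (by simp)]
      simp
    rw [h, coeff_monomial]
    split_ifs <;> simp
  simp only [h2]
  rw [Finset.sum_eq_single (κ : Fin n → ℕ)]
  · simp
  · intro e _ he
    rw [if_neg]
    rintro rfl
    exact he (by simp)
  · intro h
    exact absurd (Fintype.mem_piFinset.mpr fun r => Finset.mem_range.mpr (hL.2 r)) h

/-- Extracting a coefficient turns the Vandermonde product into a determinant. -/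
theorem coeff_vdm_mul_prod_aeval (p : Polynomial A) (κ : Fin n →₀ ℕ) :
    (vdm n A * ∏ r, Polynomial.aeval (X r : MvPolynomial (Fin n) A) p).coeff κ =
      (of fun r c : Fin n => (Polynomial.X ^ (c : ℕ) * p).coeff (κ r)).det := by
  have hv : vdm n A = ∑ σ : Equiv.Perm (Fin n), Equiv.Perm.sign σ •
      ∏ r, (X r : MvPolynomial (Fin n) A) ^ (σ r : ℕ) := det_X_pow_eq_sum fun c => c
  rw [hv, Finset.sum_mul, coeff_sum, ← det_transpose, det_apply]
  refine Finset.sum_congr rfl fun σ _ => ?_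
  rw [smul_mul_assoc, ← Finset.prod_mul_distrib, Units.smul_def, Units.smul_def, coeff_smul]
  congr 1
  refine Eq.trans ?_ (coeff_prod_aeval_X (fun r => Polynomial.X ^ (σ r : ℕ) * p) κ)
  congr 2
  ext1 r
  rw [map_mul, map_pow, Polynomial.aeval_X]

end Vandermonde

/-! ### First and second order equations for `charMoment` -/

section SpectralEquations

open Matrix MvPolynomial

variable {N n : ℕ}

/-- The operator `θ_r - c`, where `θ_r` is the Euler operator `theta r`. -/
noncomputable def shiftedTheta {σ A : Type*} [CommRing A] (c : ℕ) (r : σ) (P : MvPolynomial σ A) :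
    MvPolynomial σ A := theta r P - c * P

section Generic

variable {A : Type*} [CommRing A]

theorem theta_prod_erase (f : Fin n → MvPolynomial (Fin n) A)
    (hf : ∀ r s, r ≠ s → theta r (f s) = 0) (s : Finset (Fin n)) (r : Fin n) (hr : r ∈ s) :
    theta r (∏ i ∈ s, f i) = theta r (f r) * ∏ i ∈ s.erase r, f i := by
  rw [Derivation.map_prod_eq_sum, Finset.sum_eq_single_of_mem r hr, mul_comm]
  intro b _ hb
  rw [hf r b hb.symm, mul_zero]

theorem shiftedTheta_prod (f : Fin n → MvPolynomial (Fin n) A)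
    (hf : ∀ r s, r ≠ s → theta r (f s) = 0) (c : ℕ) (s : Finset (Fin n)) (r : Fin n) (hr : r ∈ s) :
    shiftedTheta c r (∏ i ∈ s, f i) = shiftedTheta c r (f r) * ∏ i ∈ s.erase r, f i := by
  rw [shiftedTheta, shiftedTheta, theta_prod_erase f hf s r hr, ← Finset.mul_prod_erase s f hr]
  ring

theorem shiftedTheta_shiftedTheta_prod (f : Fin n → MvPolynomial (Fin n) A)
    (hf : ∀ r s, r ≠ s → theta r (f s) = 0)
    (hf' : ∀ r s, r ≠ s → theta r (theta s (f s)) = 0) (c : ℕ) (r s : Fin n) (hrs : r ≠ s) :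
    shiftedTheta c s (shiftedTheta c r (∏ i, f i)) =
      shiftedTheta c r (f r) * shiftedTheta c s (f s) *
        ∏ i ∈ (Finset.univ.erase r).erase s, f i := by
  have h0 : theta s (shiftedTheta c r (f r)) = 0 := by
    rw [shiftedTheta, map_sub, Derivation.leibniz, hf' s r hrs.symm, hf s r hrs.symm,
      Derivation.map_natCast, smul_zero, smul_zero, add_zero, sub_zero]
  rw [shiftedTheta_prod f hf c _ r (Finset.mem_univ r), shiftedTheta, Derivation.leibniz, h0,
    smul_zero, add_zero, smul_eq_mul, mul_assoc (shiftedTheta c r (f r)),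
    ← shiftedTheta_prod f hf c _ s (Finset.mem_erase.mpr ⟨hrs.symm, Finset.mem_univ s⟩)]
  simp only [shiftedTheta]
  ring

/-- Multiplication by the Vandermonde product turns the pair interaction into first derivatives of
the Vandermonde product. -/
theorem vdm_mul_sum_sum (f : Fin n → MvPolynomial (Fin n) A)
    (hf : ∀ r s, r ≠ s → theta r (f s) = 0)
    (hf' : ∀ r s, r ≠ s → theta r (theta s (f s)) = 0) (c : ℕ)
    (t : Fin n → Fin n → MvPolynomial (Fin n) A) (ht : ∀ r s, t r s = t s r)
    (hT : ∀ r s, (X r - X s) * t r s =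
      X s * f r * shiftedTheta c s (f s) - X r * f s * shiftedTheta c r (f r)) :
    vdm n A * ∑ r, ∑ s ∈ Finset.univ.erase r,
        (shiftedTheta c r (f r) * shiftedTheta c s (f s) + t r s) *
          ∏ i ∈ (Finset.univ.erase r).erase s, f i =
      vdm n A * (∑ r, ∑ s, shiftedTheta c s (shiftedTheta c r (∏ i, f i))
          - ∑ r, shiftedTheta c r (shiftedTheta c r (∏ i, f i)))
        - 2 * ∑ r, theta r (vdm n A) * shiftedTheta c r (∏ i, f i) := by
  have h1 : ∑ r, ∑ s ∈ Finset.univ.erase r, shiftedTheta c r (f r) * shiftedTheta c s (f s) *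
        ∏ i ∈ (Finset.univ.erase r).erase s, f i =
      ∑ r, ∑ s, shiftedTheta c s (shiftedTheta c r (∏ i, f i))
        - ∑ r, shiftedTheta c r (shiftedTheta c r (∏ i, f i)) := by
    rw [← Finset.sum_sub_distrib]
    refine Finset.sum_congr rfl fun r _ => ?_
    rw [← Finset.add_sum_erase _ _ (Finset.mem_univ r), add_sub_cancel_left]
    refine Finset.sum_congr rfl fun s hs => ?_
    rw [shiftedTheta_shiftedTheta_prod f hf hf' c r s (Finset.ne_of_mem_erase hs).symm]
  have h2 : vdm n A * ∑ r, ∑ s ∈ Finset.univ.erase r, t r s *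
        ∏ i ∈ (Finset.univ.erase r).erase s, f i =
      -(2 * ∑ r, theta r (vdm n A) * shiftedTheta c r (∏ i, f i)) := by
    rw [sum_sum_erase_eq_two_mul (fun r s => t r s * ∏ i ∈ (Finset.univ.erase r).erase s, f i),
      sum_theta_vdm_mul, mul_left_comm, ← mul_neg, Finset.mul_sum, ← Finset.sum_neg_distrib]
    · congr 1
      refine Finset.sum_congr rfl fun p hp => ?_
      have hlt : p.1 < p.2 := (Finset.mem_filter.mp hp).2
      have m1 : p.1 ∈ Finset.univ.erase p.2 := Finset.mem_erase.mpr ⟨hlt.ne, Finset.mem_univ _⟩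
      have m2 : p.2 ∈ Finset.univ.erase p.1 := Finset.mem_erase.mpr ⟨hlt.ne', Finset.mem_univ _⟩
      rw [shiftedTheta_prod f hf c _ p.1 (Finset.mem_univ _),
        shiftedTheta_prod f hf c _ p.2 (Finset.mem_univ _), ← Finset.mul_prod_erase _ f m1,
        ← Finset.mul_prod_erase _ f m2, Finset.erase_right_comm (a := p.2), vdm_eq_prod,
        ← Finset.mul_prod_erase _ _ hp]
      have := hT p.1 p.2
      generalize ∏ q ∈ (ltPairs n).erase p, (X q.2 - X q.1 : MvPolynomial (Fin n) A) = W at *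
      generalize ∏ i ∈ (Finset.univ.erase p.1).erase p.2, f i = Y at *
      linear_combination (-W * Y) * this
    · intro r s
      rw [ht, Finset.erase_right_comm]
  rw [← h1, sub_eq_add_neg, ← h2, ← mul_add, ← Finset.sum_add_distrib]
  congr 1
  refine Finset.sum_congr rfl fun r _ => ?_
  rw [← Finset.sum_add_distrib]
  exact Finset.sum_congr rfl fun s _ => by ring

end Generic

theorem charFactor_eq_eval (r : Fin n) :
    charFactor N r = (liftU N n).charpoly.eval (X r) := (eval_charpoly _ _).symm

theorem charFactor_eq_aeval (r : Fin n) :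
    charFactor N r = Polynomial.aeval (X r) (genericU N).charpoly := by
  have h : (liftU N n).charpoly = (genericU N).charpoly.map C := by
    rw [← charpoly_map]; rfl
  rw [charFactor_eq_eval, h, Polynomial.eval_map, Polynomial.aeval_def]
  rfl

theorem theta_aeval_X {A : Type*} [CommRing A] (p : Polynomial A) (r s : Fin n) :
    theta r (Polynomial.aeval (X s : MvPolynomial (Fin n) A) p) =
      if r = s then X s * Polynomial.aeval (X s) (Polynomial.derivative p) else 0 := by
  rw [Derivation.map_aeval, theta_X, smul_eq_mul]
  split_ifs
  · rw [mul_comm]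
  · rw [mul_zero]

theorem theta_charFactor_of_ne (r s : Fin n) (h : r ≠ s) : theta r (charFactor N s) = 0 := by
  rw [charFactor_eq_aeval, theta_aeval_X, if_neg h]

theorem theta_theta_charFactor_of_ne (r s : Fin n) (h : r ≠ s) :
    theta r (theta s (charFactor N s)) = 0 := by
  rw [charFactor_eq_aeval, theta_aeval_X, if_pos rfl, Derivation.leibniz, theta_aeval_X, if_neg h,
    theta_X, if_neg h, smul_zero, smul_zero, add_zero]

/-- `tr (U adj (x_r - U))` is the image of `det (x_r - U)` under `θ_r - N`. -/
theorem trace_adjResolvent (r : Fin n) :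
    (adjResolvent N r).trace = shiftedTheta N r (charFactor N r) := by
  have h : (liftU N n).charpoly = (genericU N).charpoly.map C := by
    rw [← charpoly_map]; rfl
  rw [adjResolvent, trace_mul_adjugate_scalar_sub, shiftedTheta, ← charFactor_eq_eval,
    Fintype.card_fin]
  rw [charFactor_eq_aeval, theta_aeval_X, if_pos rfl, h, Polynomial.derivative_map,
    Polynomial.eval_map, Polynomial.aeval_def, Polynomial.aeval_def, MvPolynomial.algebraMap_eq]

theorem sub_mul_trace_adjResolvent_mul (r s : Fin n) :
    (X r - X s) * (adjResolvent N r * adjResolvent N s).trace =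
      X s * charFactor N r * shiftedTheta N s (charFactor N s)
        - X r * charFactor N s * shiftedTheta N r (charFactor N r) := by
  have h := congrArg trace (sub_smul_mul_adjugate_mul_adjugate (liftU N n) (X r) (X s))
  rw [trace_smul, trace_sub, trace_smul, trace_smul] at h
  rw [← trace_adjResolvent, ← trace_adjResolvent]
  exact h

theorem coeffwise_shiftedTheta_mul_C {σ A : Type*} [CommRing A] [Algebra ℂ A] (E : A →ₗ[ℂ] ℂ)
    (c : ℕ) (r : σ) (P : MvPolynomial σ A) (a : A) :
    coeffwise E (shiftedTheta c r P * C a) = shiftedTheta c r (coeffwise E (P * C a)) := by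
  have h : shiftedTheta c r P * C a = theta r (P * C a) - (c : MvPolynomial σ A) * (P * C a) := by
    have : theta r (C a : MvPolynomial σ A) = 0 := by rw [theta_apply, pderiv_C, mul_zero]
    rw [shiftedTheta, Derivation.leibniz, this, smul_zero, zero_add, smul_eq_mul]
    ring
  rw [h, map_sub, coeffwise_theta, map_natCast_mul_eq, shiftedTheta]

/-- The first order equation: `charMoment` is homogeneous of degree `n N - m N`. -/
theorem sum_shiftedTheta_charMoment (m : ℕ) :
    ∑ r, shiftedTheta N r (charMoment N n m) =
      -algebraMap ℂ (MvPolynomial (Fin n) ℂ) ((m : ℂ) * N) * charMoment N n m := by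
  rw [← coeffwise_sum_trace, Finset.sum_mul, map_sum]
  refine Finset.sum_congr rfl fun r _ => ?_
  rw [charMoment, ← coeffwise_shiftedTheta_mul_C,
    shiftedTheta_prod _ theta_charFactor_of_ne N _ r (Finset.mem_univ r), trace_adjResolvent]

theorem map_sub_mul_eq {A R : Type*} [CommRing A] [Algebra ℂ A] [AddCommGroup R] [Module ℂ R]
    (E : A →ₗ[ℂ] R) (a b c : A) : E ((a - b) * c) = E (a * c) - E (b * c) := by
  rw [sub_mul, map_sub]

theorem sub_mul_mul_eq {A : Type*} [CommRing A] (a b c d : A) :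
    (a * b - 2 * c) * d = a * (b * d) - 2 * (c * d) := by ring

/-- The second order equation, the mean of `vdm_mul_sum_sum` for the factors `det (x_r - U)`. -/
theorem second_order_charMoment (m : ℕ) :
    vdm n ℂ * (∑ r, ∑ s, shiftedTheta N s (shiftedTheta N r (charMoment N n m))
        - ∑ r, shiftedTheta N r (shiftedTheta N r (charMoment N n m)))
      - 2 * ∑ r, theta r (vdm n ℂ) * shiftedTheta N r (charMoment N n m) =
    algebraMap ℂ (MvPolynomial (Fin n) ℂ) ((N : ℂ) * (N + 1) * (m * (m - 1))) *
      (vdm n ℂ * charMoment N n m) := by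
  have h := congrArg (fun P => coeffwise (haarMean N) (P * C (invDet N ^ m)))
    (vdm_mul_sum_sum (charFactor N (n := n)) theta_charFactor_of_ne theta_theta_charFactor_of_ne N
      (fun r s => (adjResolvent N r * adjResolvent N s).trace) (fun r s => trace_mul_comm _ _)
      sub_mul_trace_adjResolvent_mul)
  have hV : vdm n (UFun N) = map (algebraMap ℂ (UFun N)) (vdm n ℂ) := (map_vdm _).symm
  have hθ : ∀ r, theta r (vdm n (UFun N)) = map (algebraMap ℂ (UFun N)) (theta r (vdm n ℂ)) := by
    intro r
    rw [theta_apply, theta_apply, hV, map_mul, map_X, pderiv_map]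
  have h2 := coeffwise_sum_trace_mul_trace (N := N) (n := n) m
  simp only [trace_adjResolvent] at h2
  have hsh : ∀ r s, coeffwise (haarMean N) (shiftedTheta N s (shiftedTheta N r
      (∏ i : Fin n, charFactor N i)) * C (invDet N ^ m)) =
      shiftedTheta N s (shiftedTheta N r (charMoment N n m)) := by
    intro r s
    rw [coeffwise_shiftedTheta_mul_C, coeffwise_shiftedTheta_mul_C, ← charMoment]
  rw [hV, mul_assoc, coeffwise_map_mul, h2, sub_mul_mul_eq, map_sub, coeffwise_map_mul,
    map_ofNat_mul_eq, Finset.sum_mul, map_sum, map_sub_mul_eq, Finset.sum_mul, map_sum,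
    Finset.sum_mul, map_sum] at h
  simp only [Finset.sum_mul, map_sum, hsh] at h
  rw [mul_left_comm, h]
  congr 2
  refine Finset.sum_congr rfl fun r _ => ?_
  rw [← hV, hθ, mul_assoc, coeffwise_map_mul, coeffwise_shiftedTheta_mul_C, ← charMoment]

end SpectralEquations

/-! ### The support of `vdm * charMoment` -/

section Support

open Matrix MvPolynomial

variable {N n : ℕ}

theorem sum_shiftedTheta_shiftedTheta_charMoment (m : ℕ) :
    ∑ r, ∑ s, shiftedTheta N s (shiftedTheta N r (charMoment N n m)) =
      algebraMap ℂ (MvPolynomial (Fin n) ℂ) (((m : ℂ) * N) ^ 2) * charMoment N n m := by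
  have h1 : ∀ s : Fin n, ∑ r, shiftedTheta N s (shiftedTheta N r (charMoment N n m)) =
      -algebraMap ℂ (MvPolynomial (Fin n) ℂ) ((m : ℂ) * N) *
        shiftedTheta N s (charMoment N n m) := by
    intro s
    have : ∑ r, shiftedTheta N s (shiftedTheta N r (charMoment N n m)) =
        shiftedTheta N s (∑ r, shiftedTheta N r (charMoment N n m)) := by
      rw [shiftedTheta, map_sum, Finset.mul_sum, ← Finset.sum_sub_distrib]
      rfl
    rw [this, sum_shiftedTheta_charMoment, shiftedTheta, shiftedTheta, Derivation.leibniz, map_neg,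
      Derivation.map_algebraMap, neg_zero, smul_zero, add_zero, smul_eq_mul]
    ring
  rw [Finset.sum_comm]
  simp only [h1, ← Finset.mul_sum]
  rw [sum_shiftedTheta_charMoment, map_pow]
  ring

theorem sum_theta_vdm_mul_charMoment (m : ℕ) :
    ∑ r, theta r (vdm n ℂ * charMoment N n m) =
      algebraMap ℂ (MvPolynomial (Fin n) ℂ) ((∑ i ∈ Finset.range n, i : ℕ) + n * N - m * N) *
        (vdm n ℂ * charMoment N n m) := by
  have h1 := sum_shiftedTheta_charMoment (N := N) (n := n) m
  have h2 := sum_theta_vdm (n := n) (A := ℂ)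
  simp only [shiftedTheta, Finset.sum_sub_distrib, Finset.sum_const, Finset.card_univ,
    Fintype.card_fin, nsmul_eq_mul] at h1
  simp only [Derivation.leibniz, smul_eq_mul, Finset.sum_add_distrib, ← Finset.mul_sum]
  simp only [map_add, map_sub, map_mul, map_natCast] at h1 h2 ⊢
  linear_combination vdm n ℂ * h1 + charMoment N n m * h2

/-- The second order equation conjugated by the Vandermonde product: the terms that couple distinct
variables cancel. -/
theorem sum_theta_theta_vdm_mul_charMoment (m : ℕ) :
    ∑ r, theta r (theta r (vdm n ℂ * charMoment N n m)) =
      2 * N * ∑ r, theta r (vdm n ℂ * charMoment N n m) +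
      algebraMap ℂ (MvPolynomial (Fin n) ℂ) ((m * N) ^ 2 + (∑ i ∈ Finset.range n, i ^ 2 : ℕ)
        - n * N ^ 2 - N * (N + 1) * (m * (m - 1))) * (vdm n ℂ * charMoment N n m) := by
  have h1 := second_order_charMoment (N := N) (n := n) m
  rw [sum_shiftedTheta_shiftedTheta_charMoment] at h1
  have h2 := sum_theta_theta_vdm (n := n) (A := ℂ)
  generalize vdm n ℂ = V at *
  generalize charMoment N n m = F at *
  have e1 : ∑ r, shiftedTheta N r (shiftedTheta N r F) =
      ∑ r, theta r (theta r F) - 2 * N * ∑ r, theta r F + n * N ^ 2 * F := by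
    have : ∀ r, shiftedTheta N r (shiftedTheta N r F) =
        theta r (theta r F) - 2 * N * theta r F + N ^ 2 * F := by
      intro r
      simp only [shiftedTheta, map_sub, Derivation.leibniz, smul_eq_mul, Derivation.map_natCast,
        mul_zero, add_zero]
      ring
    simp only [this, Finset.sum_add_distrib, Finset.sum_sub_distrib, ← Finset.mul_sum,
      Finset.sum_const, Finset.card_univ, Fintype.card_fin, nsmul_eq_mul]
    ring
  have e2 : ∑ r, theta r V * shiftedTheta N r F =
      ∑ r, theta r V * theta r F - N * (∑ r, theta r V) * F := by
    rw [Finset.mul_sum, Finset.sum_mul, ← Finset.sum_sub_distrib]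
    refine Finset.sum_congr rfl fun r _ => ?_
    rw [shiftedTheta]
    ring
  have e3 : ∑ r, theta r (V * F) = V * ∑ r, theta r F + (∑ r, theta r V) * F := by
    simp only [Derivation.leibniz, smul_eq_mul, Finset.sum_add_distrib, Finset.mul_sum,
      Finset.sum_mul, mul_comm F]
  have e4 : ∑ r, theta r (theta r (V * F)) = V * ∑ r, theta r (theta r F) +
      2 * ∑ r, theta r V * theta r F + (∑ r, theta r (theta r V)) * F := by
    have : ∀ r, theta r (theta r (V * F)) = V * theta r (theta r F) +
        2 * (theta r V * theta r F) + theta r (theta r V) * F := by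
      intro r
      rw [Derivation.leibniz, map_add, smul_eq_mul, smul_eq_mul, Derivation.leibniz,
        Derivation.leibniz, smul_eq_mul, smul_eq_mul, smul_eq_mul, smul_eq_mul]
      ring
    simp only [this, Finset.sum_add_distrib, Finset.mul_sum, Finset.sum_mul]
  rw [e1, e2] at h1
  rw [e3, e4, h2]
  simp only [map_add, map_sub, map_mul, map_natCast, map_pow, map_one] at h1 ⊢
  linear_combination -h1

theorem sum_eq_of_coeff_ne_zero (m : ℕ) (κ : Fin n →₀ ℕ)
    (h : (vdm n ℂ * charMoment N n m).coeff κ ≠ 0) :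
    ((∑ r, κ r : ℕ) : ℂ) = (∑ i ∈ Finset.range n, i : ℕ) + n * N - m * N := by
  have h1 := congrArg (coeff κ) (sum_theta_vdm_mul_charMoment (N := N) (n := n) m)
  rw [coeff_sum, MvPolynomial.algebraMap_eq, coeff_C_mul] at h1
  simp only [coeff_theta, ← Finset.sum_mul] at h1
  rw [Nat.cast_sum]
  exact mul_right_cancel₀ h h1

theorem sum_sq_eq_of_coeff_ne_zero (m : ℕ) (κ : Fin n →₀ ℕ)
    (h : (vdm n ℂ * charMoment N n m).coeff κ ≠ 0) :
    ((∑ r, κ r ^ 2 : ℕ) : ℂ) = 2 * N * (∑ r, κ r : ℕ) + ((m * N) ^ 2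
      + (∑ i ∈ Finset.range n, i ^ 2 : ℕ) - n * N ^ 2 - N * (N + 1) * (m * (m - 1))) := by
  have h1 := congrArg (coeff κ) (sum_theta_theta_vdm_mul_charMoment (N := N) (n := n) m)
  have h2 : (2 * N : MvPolynomial (Fin n) ℂ) = C (2 * (N : ℂ)) := by
    rw [C_mul, map_natCast, map_ofNat]
  rw [coeff_sum, MvPolynomial.algebraMap_eq, coeff_add, coeff_C_mul, h2, coeff_C_mul,
    coeff_sum] at h1
  simp only [coeff_theta, ← Finset.sum_mul, ← mul_assoc] at h1
  rw [← add_mul] at h1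
  have h3 := mul_right_cancel₀ h h1
  have h4 : ∑ i, (κ i : ℂ) ^ 2 = ∑ i, (κ i : ℂ) * κ i :=
    Finset.sum_congr rfl fun i _ => by ring
  push_cast at h3 ⊢
  rw [h4, h3]
  ring

/-- The coefficients of the Vandermonde product times `charMoment` are means of determinants. -/
theorem coeff_vdm_mul_charMoment (m : ℕ) (κ : Fin n →₀ ℕ) :
    (vdm n ℂ * charMoment N n m).coeff κ = haarMean N
      ((of fun r c : Fin n => (Polynomial.X ^ (c : ℕ) * (genericU N).charpoly).coeff (κ r)).det
        * invDet N ^ m) := by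
  rw [charMoment, ← coeffwise_map_mul, coeff_coeffwise, map_vdm, ← mul_assoc, mul_comm _ (C _),
    coeff_C_mul, ← coeff_vdm_mul_prod_aeval, mul_comm]
  simp only [charFactor_eq_aeval]

theorem injective_of_coeff_ne_zero (m : ℕ) (κ : Fin n →₀ ℕ)
    (h : (vdm n ℂ * charMoment N n m).coeff κ ≠ 0) : Function.Injective κ := by
  intro r s hrs
  by_contra hne
  apply h
  rw [coeff_vdm_mul_charMoment, det_zero_of_row_eq hne, zero_mul, map_zero]
  ext1 c
  simp only [of_apply, hrs]

theorem lt_of_coeff_ne_zero (m : ℕ) (κ : Fin n →₀ ℕ)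
    (h : (vdm n ℂ * charMoment N n m).coeff κ ≠ 0) (r : Fin n) : κ r < n + N := by
  by_contra hle
  apply h
  rw [coeff_vdm_mul_charMoment, det_eq_zero_of_row_eq_zero r, zero_mul, map_zero]
  intro c
  rw [of_apply]
  apply Polynomial.coeff_eq_zero_of_natDegree_lt
  have h1 := Polynomial.natDegree_mul_le (p := Polynomial.X ^ (c : ℕ)) (q := (genericU N).charpoly)
  have : Nontrivial (UFun N) := inferInstance
  have h2 : (genericU N).charpoly.natDegree = N := by
    rw [charpoly_natDegree_eq_dim, Fintype.card_fin]
  have h3 := Polynomial.natDegree_X_pow_le (R := UFun N) (c : ℕ)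
  have := c.2
  omega

/-- Among the sets of `n` exponents below `n + N` with the two power sums forced by the spectral
equations, only the complement of the block `m, …, m + N - 1` survives: the values of
`(c - m) (c - m - N + 1)` on the complement must have the least possible sum. -/
theorem not_mem_block_of_coeff_ne_zero (m : ℕ) (κ : Fin n →₀ ℕ)
    (h : (vdm n ℂ * charMoment N n m).coeff κ ≠ 0) (r : Fin n) : κ r < m ∨ m + N ≤ κ r := by
  have hinj := injective_of_coeff_ne_zero m κ h
  have hlt := lt_of_coeff_ne_zero m κ h
  have h1 : ((∑ r, κ r : ℕ) : ℤ) = (∑ i ∈ Finset.range n, i : ℕ) + n * N - m * N := by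
    exact_mod_cast sum_eq_of_coeff_ne_zero m κ h
  have h2 : ((∑ r, κ r ^ 2 : ℕ) : ℤ) = 2 * N * (∑ r, κ r : ℕ) + ((m * N) ^ 2
      + (∑ i ∈ Finset.range n, i ^ 2 : ℕ) - n * N ^ 2 - N * (N + 1) * (m * (m - 1))) := by
    exact_mod_cast sum_sq_eq_of_coeff_ne_zero m κ h
  set S : Finset ℕ := Finset.univ.map ⟨κ, hinj⟩ with hS
  set φ : ℕ → ℤ := fun c => ((c : ℤ) - m) * (c - m - N + 1) with hφ
  have hid : ∀ k : ℕ, 2 * ((∑ i ∈ Finset.range k, i : ℕ) : ℤ) = k * (k - 1) := by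
    intro k
    induction k with
    | zero => simp
    | succ k ih => rw [Finset.sum_range_succ]; push_cast at ih ⊢; linarith
  have hsq : ∀ k : ℕ, 6 * ((∑ i ∈ Finset.range k, i ^ 2 : ℕ) : ℤ) = k * (k - 1) * (2 * k - 1) := by
    intro k
    induction k with
    | zero => simp
    | succ k ih => rw [Finset.sum_range_succ]; push_cast at ih ⊢; linarith
  have hSφ : ∑ c ∈ S, φ c = (∑ r, κ r ^ 2 : ℕ) - (2 * m + N - 1) * (∑ r, κ r : ℕ)
      + n * (m * (m + N - 1)) := by
    rw [hS, Finset.sum_map]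
    simp only [hφ, Function.Embedding.coeFn_mk]
    push_cast
    rw [Finset.mul_sum, ← Finset.sum_sub_distrib]
    have : (n : ℤ) * (m * (m + N - 1)) = ∑ r : Fin n, ((m : ℤ) * (m + N - 1)) := by simp
    rw [this, ← Finset.sum_add_distrib]
    exact Finset.sum_congr rfl fun i _ => by ring
  have hall : ∀ k : ℕ, ∑ c ∈ Finset.range k, φ c = (∑ i ∈ Finset.range k, i ^ 2 : ℕ)
      - (2 * m + N - 1) * (∑ i ∈ Finset.range k, i : ℕ) + k * (m * (m + N - 1)) := by
    intro k
    induction k with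
    | zero => simp
    | succ k ih =>
      rw [Finset.sum_range_succ, Finset.sum_range_succ, Finset.sum_range_succ, ih]
      simp only [hφ]
      push_cast
      ring
  have hblock : ∑ c ∈ Finset.Ico m (m + N), φ c =
      ∑ c ∈ Finset.range (m + N), φ c - ∑ c ∈ Finset.range m, φ c := by
    rw [Finset.sum_Ico_eq_sub _ (Nat.le_add_right m N)]
  -- The sum of `φ` over the complement of the exponents equals its sum over the block.
  have hcompl : ∑ c ∈ Finset.range (n + N) \ S, φ c = ∑ c ∈ Finset.Ico m (m + N), φ c := by
    have hsub : S ⊆ Finset.range (n + N) := by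
      intro c hc
      obtain ⟨r, -, rfl⟩ := Finset.mem_map.mp hc
      exact Finset.mem_range.mpr (hlt r)
    have := Finset.sum_sdiff hsub (f := φ)
    have e1 := hid n; have e2 := hid (n + N); have e3 := hid (m + N); have e4 := hid m
    have f1 := hsq n; have f2 := hsq (n + N); have f3 := hsq (m + N); have f4 := hsq m
    rw [eq_sub_of_add_eq this, hblock, hall, hall, hall, hSφ, h2, h1]
    generalize ((∑ i ∈ Finset.range n, i : ℕ) : ℤ) = a1 at *
    generalize ((∑ i ∈ Finset.range (n + N), i : ℕ) : ℤ) = a2 at *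
    generalize ((∑ i ∈ Finset.range (m + N), i : ℕ) : ℤ) = a3 at *
    generalize ((∑ i ∈ Finset.range m, i : ℕ) : ℤ) = a4 at *
    generalize ((∑ i ∈ Finset.range n, i ^ 2 : ℕ) : ℤ) = b1 at *
    generalize ((∑ i ∈ Finset.range (n + N), i ^ 2 : ℕ) : ℤ) = b2 at *
    generalize ((∑ i ∈ Finset.range (m + N), i ^ 2 : ℕ) : ℤ) = b3 at *
    generalize ((∑ i ∈ Finset.range m, i ^ 2 : ℕ) : ℤ) = b4 at *
    push_cast at *
    refine mul_left_cancel₀ (by norm_num : (6 : ℤ) ≠ 0) ?_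
    linear_combination f2 - f1 - f3 + f4 - 3 * (2 * m + N - 1) * (e2 - e3 + e4)
      + 3 * (2 * m - N - 1) * e1
  have hcard : (Finset.range (n + N) \ S).card = (Finset.Ico m (m + N)).card := by
    have hsub : S ⊆ Finset.range (n + N) := by
      intro c hc
      obtain ⟨r, -, rfl⟩ := Finset.mem_map.mp hc
      exact Finset.mem_range.mpr (hlt r)
    rw [Finset.card_sdiff_of_subset hsub, hS, Finset.card_map]
    simp
  set T := Finset.range (n + N) \ S with hT
  by_contra hr
  have hrS : κ r ∈ S := Finset.mem_map.mpr ⟨r, Finset.mem_univ r, rfl⟩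
  have hrB : κ r ∈ Finset.Ico m (m + N) := by
    rw [Finset.mem_Ico]; omega
  have hpos : ∀ c ∈ T \ Finset.Ico m (m + N), 0 < φ c := by
    intro c hc
    have := (Finset.mem_sdiff.mp hc).2
    rw [Finset.mem_Ico, not_and_or] at this
    have hN : 0 < N := by
      rw [Finset.mem_Ico] at hrB; omega
    simp only [hφ]
    rcases this with h | h
    · have : (c : ℤ) < m := by omega
      nlinarith
    · apply mul_pos <;> omega
  have hneg : ∀ c ∈ Finset.Ico m (m + N) \ T, φ c ≤ 0 := by
    intro c hc
    have := (Finset.mem_sdiff.mp hc).1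
    rw [Finset.mem_Ico] at this
    simp only [hφ]
    apply mul_nonpos_of_nonneg_of_nonpos <;> omega
  have hdiff : ∑ c ∈ T \ Finset.Ico m (m + N), φ c = ∑ c ∈ Finset.Ico m (m + N) \ T, φ c := by
    have a1 := Finset.sum_sdiff_sub_sum_sdiff (s₁ := T) (s₂ := Finset.Ico m (m + N)) (f := φ)
    rw [hcompl, sub_self] at a1
    linarith
  have hne : (T \ Finset.Ico m (m + N)).Nonempty := by
    rw [← Finset.card_pos, Finset.card_sdiff_comm hcard, Finset.card_pos]
    exact ⟨κ r, Finset.mem_sdiff.mpr ⟨hrB, fun hc => (Finset.mem_sdiff.mp hc).2 hrS⟩⟩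
  have := Finset.sum_pos hpos hne
  have := Finset.sum_nonpos hneg
  linarith

end Support

/-! ### An alternant with a gap as a Toeplitz determinant -/

section Bialternant

open Matrix Polynomial

variable {N n : ℕ}

/-- The increasing enumeration of the natural numbers outside the block `m, …, m + N - 1`. -/
def skipBlock (m N c : ℕ) : ℕ := if c < m then c else c + N

/-- A Vandermonde-type determinant with a gap of length `N` in the exponents is, up to sign, the
Vandermonde determinant times an `N × N` determinant in the coefficients of `∏ r, (X - x_r)`: the
matrix with rows `(x_r ^ c)_c` and unit rows for the gap is expanded in the basis
`1, X, …, X ^ (n - 1), G, G * X, …, G * X ^ (N - 1)` with `G = ∏ r, (X - x_r)`. -/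
theorem exists_sign_det_skipBlock {R : Type*} [CommRing R] [Nontrivial R] (m N : ℕ) (hmn : m ≤ n)
    (x : Fin n → R) : ∃ s : ℤˣ,
      (of fun r c : Fin n => x r ^ skipBlock m N c).det * ((s : ℤ) : R) = (vandermonde x).det *
        (of fun i j : Fin N => ((∏ r, (X - C (x r))) * X ^ (j : ℕ)).coeff (m + i)).det := by
  set G : R[X] := ∏ r, (X - C (x r)) with hG
  have hGm : G.Monic := monic_prod_of_monic _ _ fun r _ => monic_X_sub_C _
  have hGd : G.natDegree = n := by
    rw [hG, natDegree_prod_of_monic _ _ fun r _ => monic_X_sub_C _]; simp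
  set e : Fin n ⊕ Fin N → ℕ := Sum.elim (fun s => skipBlock m N s) fun i => m + i with he
  have he_lt : ∀ a, e a < n + N := by
    rintro (s | i)
    · have := s.2
      simp only [he, Sum.elim_inl, skipBlock]; split_ifs <;> omega
    · have := i.2
      simp only [he, Sum.elim_inr]; omega
  have he_inj : Function.Injective e := by
    rintro (s | i) (s' | i') h
    · simp only [he, Sum.elim_inl, skipBlock] at h
      congr 1; ext
      split_ifs at h <;> omega
    · have := i'.2
      simp only [he, Sum.elim_inl, Sum.elim_inr, skipBlock] at h
      split_ifs at h <;> omega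
    · have := i.2
      simp only [he, Sum.elim_inl, Sum.elim_inr, skipBlock] at h
      split_ifs at h <;> omega
    · simp only [he, Sum.elim_inr] at h
      congr 1; ext; omega
  set e1 : Fin n ⊕ Fin N ≃ Fin (n + N) := Equiv.ofBijective (fun a => ⟨e a, he_lt a⟩)
    ((Fintype.bijective_iff_injective_and_card _).mpr
      ⟨fun a b h => he_inj (Fin.mk.inj_iff.mp h), by simp⟩) with he1
  have he1_apply : ∀ a, (e1 a : ℕ) = e a := fun a => rfl
  set e0 : Fin n ⊕ Fin N ≃ Fin (n + N) := finSumFinEquiv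
  set q : Fin (n + N) → R[X] := fun c => if (c : ℕ) < n then X ^ (c : ℕ) else G * X ^ ((c : ℕ) - n)
    with hq
  have hqm : ∀ c, (q c).Monic := by
    intro c
    simp only [hq]
    split_ifs
    · exact monic_X_pow _
    · exact hGm.mul (monic_X_pow _)
  have hqd : ∀ c, (q c).natDegree = c := by
    intro c
    simp only [hq]
    split_ifs
    · exact natDegree_X_pow _
    · rw [hGm.natDegree_mul (monic_X_pow _), hGd, natDegree_X_pow]; omega
  have hql : ∀ j : Fin n, q (e0 (Sum.inl j)) = X ^ (j : ℕ) := by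
    intro j; simp [hq, e0]
  have hqr : ∀ j : Fin N, q (e0 (Sum.inr j)) = G * X ^ (j : ℕ) := by
    intro j; simp [hq, e0]
  set M : Matrix (Fin (n + N)) (Fin (n + N)) R := of fun i j => (q j).coeff i with hM
  have hMdet : M.det = 1 := det_matrixOfPolynomials q hqd hqm
  set W : Matrix (Fin n ⊕ Fin N) (Fin n ⊕ Fin N) R :=
    fromBlocks (of fun r c : Fin n => x r ^ skipBlock m N c)
      (of fun r (i : Fin N) => x r ^ (m + (i : ℕ))) 0 1 with hW
  have hWdet : W.det = (of fun r c : Fin n => x r ^ skipBlock m N c).det := by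
    rw [hW, det_fromBlocks_zero₂₁, det_one, mul_one]
  have hprod : W * M.submatrix e1 e0 = fromBlocks (vandermonde x) 0
      (of fun (i : Fin N) (j : Fin n) => (X ^ (j : ℕ) : R[X]).coeff (m + i))
      (of fun i j : Fin N => (G * X ^ (j : ℕ)).coeff (m + i)) := by
    have hrow : ∀ r c, (W * M.submatrix e1 e0) (Sum.inl r) c = (q (e0 c)).eval (x r) := by
      intro r c
      have : ∀ a, W (Sum.inl r) a = x r ^ e a := by
        rintro (s | i) <;> simp [hW, he]
      rw [mul_apply, eval_eq_sum_range' (n := n + N) (by rw [hqd]; exact (e0 c).2),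
        Finset.sum_range, ← Equiv.sum_comp e1]
      refine Finset.sum_congr rfl fun a _ => ?_
      rw [this, submatrix_apply, hM, of_apply, he1_apply, mul_comm]
    have hrow' : ∀ i c, (W * M.submatrix e1 e0) (Sum.inr i) c = (q (e0 c)).coeff (m + i) := by
      intro i c
      rw [mul_apply, Fintype.sum_eq_single (Sum.inr i)]
      · simp [hW, hM, he1_apply, he]
      · rintro (s | i') h
        · simp [hW]
        · have : i ≠ i' := fun h' => h (by rw [h'])
          simp [hW, this]
    ext1 (r | i) (c | j)
    · rw [hrow, hql]; simp [vandermonde_apply]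
    · rw [hrow, hqr, eval_mul, hG, eval_prod, Finset.prod_eq_zero (Finset.mem_univ r) (by simp)]
      simp
    · rw [hrow', hql]; simp
    · rw [hrow', hqr]; simp
  refine ⟨Equiv.Perm.sign (e0.symm.trans e1), ?_⟩
  have hsub : M.submatrix e1 e0 = (M.submatrix (e0.symm.trans e1) id).submatrix e0 e0 := by
    ext i j; simp
  have := congrArg det hprod
  rw [det_mul, hsub, det_submatrix_equiv_self, det_permute, hMdet, mul_one, hWdet,
    det_fromBlocks_zero₁₂] at this
  exact this

end Bialternant

/-! ### `charMoment` as a Toeplitz determinant -/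

section HeineSzego

open Matrix MvPolynomial

variable {N n : ℕ}

/-- By the support of its coefficients and antisymmetry, `vdm * charMoment` is a multiple of a
single alternant. -/
theorem exists_vdm_mul_charMoment_eq (m : ℕ) (hmn : m ≤ n) : ∃ c : ℂ,
    vdm n ℂ * charMoment N n m =
      C c * (of fun r s : Fin n => (X r : MvPolynomial (Fin n) ℂ) ^ skipBlock m N s).det := by
  classical
  have hk_inj : Function.Injective fun s : Fin n => skipBlock m N s := by
    intro s s' h
    simp only [skipBlock] at h
    ext; split_ifs at h <;> omega
  set κ₀ : Fin n →₀ ℕ := Finsupp.equivFunOnFinite.symm fun s => skipBlock m N s with hκ₀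
  refine ⟨(vdm n ℂ * charMoment N n m).coeff κ₀, ?_⟩
  ext κ
  have hR : ∀ σ : Equiv.Perm (Fin n),
      (∏ r, (X r : MvPolynomial (Fin n) ℂ) ^ skipBlock m N (σ r)).coeff κ =
        if (fun r => skipBlock m N (σ r)) = κ then 1 else 0 := by
    intro σ
    have h : (∏ r, (X r : MvPolynomial (Fin n) ℂ) ^ skipBlock m N (σ r)) =
        monomial (Finsupp.equivFunOnFinite.symm fun r : Fin n => skipBlock m N (σ r)) 1 := by
      rw [monomial_eq, C_1, one_mul, Finsupp.prod_fintype _ _ (by simp)]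
      simp
    rw [h, coeff_monomial]
    congr 1
    rw [Equiv.symm_apply_eq]
    rfl
  rw [coeff_C_mul, det_X_pow_eq_sum, coeff_sum]
  simp only [Units.smul_def, coeff_smul, hR]
  by_cases hσ : ∃ σ : Equiv.Perm (Fin n), (fun r => skipBlock m N (σ r)) = κ
  · obtain ⟨σ, hσ⟩ := hσ
    rw [Finset.sum_eq_single σ, if_pos hσ, coeff_vdm_mul_charMoment, coeff_vdm_mul_charMoment]
    · have h1 : (of fun r c : Fin n =>
          (Polynomial.X ^ (c : ℕ) * (genericU N).charpoly).coeff (κ r)) =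
          (of fun r c : Fin n =>
          (Polynomial.X ^ (c : ℕ) * (genericU N).charpoly).coeff (κ₀ r)).submatrix σ id := by
        ext1 r c
        rw [submatrix_apply, of_apply, of_apply, ← congrFun hσ r]
        rfl
      rw [h1, det_permute, mul_assoc, ← zsmul_eq_mul, map_zsmul, mul_smul_comm, mul_one]
    · intro τ _ hτ
      rw [if_neg, smul_zero]
      intro h
      apply hτ
      ext1 r
      exact hk_inj (congrFun (h.trans hσ.symm) r)
    · intro h; exact absurd (Finset.mem_univ σ) h
  · have h0 : ∀ σ : Equiv.Perm (Fin n), (fun r => skipBlock m N (σ r)) ≠ κ :=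
      fun σ h => hσ ⟨σ, h⟩
    simp only [h0, if_false, smul_zero, Finset.sum_const_zero, mul_zero]
    by_contra h
    have hblock := not_mem_block_of_coeff_ne_zero m κ h
    have hlt := lt_of_coeff_ne_zero m κ h
    have hinj := injective_of_coeff_ne_zero m κ h
    set f : Fin n → Fin n := fun r => ⟨if κ r < m then κ r else κ r - N, by
      have := hlt r
      have := hblock r
      split_ifs <;> omega⟩ with hf
    have hfk : ∀ r, skipBlock m N (f r) = κ r := by
      intro r
      have := hblock r
      simp only [hf, skipBlock]
      split_ifs <;> omega
    have hfi : Function.Injective f := fun r s hrs => hinj (by rw [← hfk, ← hfk, hrs])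
    exact hσ ⟨Equiv.ofBijective f (Finite.injective_iff_bijective.mp hfi), funext hfk⟩

/-- `charMoment` is a constant multiple of the Toeplitz determinant in the coefficients of
`∏ r, (T - x_r)`. -/
theorem exists_charMoment_eq (m : ℕ) (hmn : m ≤ n) : ∃ c : ℂ,
    charMoment N n m = C c * (of fun i j : Fin N => ((∏ r : Fin n, (Polynomial.X -
      Polynomial.C (X r : MvPolynomial (Fin n) ℂ))) * Polynomial.X ^ (j : ℕ)).coeff (m + i)).det := by
  obtain ⟨c, hc⟩ := exists_vdm_mul_charMoment_eq (N := N) m hmn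
  obtain ⟨s, hs⟩ := exists_sign_det_skipBlock m N hmn (X : Fin n → MvPolynomial (Fin n) ℂ)
  refine ⟨c * (s : ℤ), mul_left_cancel₀ (vdm_ne_zero (n := n) (A := ℂ)) ?_⟩
  rw [hc, mul_left_comm, vdm, ← hs]
  have h1 : (((s : ℤ) : MvPolynomial (Fin n) ℂ)) * ((s : ℤ) : MvPolynomial (Fin n) ℂ) = 1 := by
    rw [← Int.cast_mul, Int.units_coe_mul_self, Int.cast_one]
  rw [C_mul, map_intCast]
  linear_combination (-C c * (of fun r s : Fin n =>
    (X r : MvPolynomial (Fin n) ℂ) ^ skipBlock m N s).det) * h1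

end HeineSzego

/-! ### The Heine–Szegő identity -/

section HeineSzegoNormalised

open Matrix Polynomial

variable {N : ℕ}

/-- The scalar matrix `w` on the unit circle, as an element of `U(N)`. -/
noncomputable def scalarU (N : ℕ) (w : ℂ) (hw : ‖w‖ = 1) : Matrix.unitaryGroup (Fin N) ℂ :=
  ⟨w • 1, by
    rw [mem_unitaryGroup_iff, star_smul, star_one, smul_mul_smul_comm, one_mul, RCLike.star_def,
      Complex.mul_conj', hw]
    simp⟩

theorem leftTranslate_scalarU_genericU (w : ℂ) (hw : ‖w‖ = 1) :
    (genericU N).map (leftTranslate (scalarU N w hw)) =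
      algebraMap ℂ (UFun N) w • genericU N := by
  rw [leftTranslate_genericU]
  have : ((scalarU N w hw : Matrix.unitaryGroup (Fin N) ℂ) : Matrix (Fin N) (Fin N) ℂ) =
      diagonal fun _ => w := smul_one_eq_diagonal w
  rw [this, diagonal_map (map_zero _)]
  ext1 i j
  rw [diagonal_mul]
  rfl

/-- If `f (w U)` is `w ^ (-J)` times the value at `w` of a polynomial `p` with coefficients functions
of `U`, then only the coefficient of degree `J` of `p` contributes to the mean of `f`. -/
theorem haarMean_eq_haarMean_coeff (f : UFun N) (p : (UFun N)[X]) (J : ℕ)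
    (h : ∀ w (hw : ‖w‖ = 1), p.eval (algebraMap ℂ (UFun N) w) =
      algebraMap ℂ (UFun N) (w ^ J) * leftTranslate (scalarU N w hw) f) :
    haarMean N f = haarMean N (p.coeff J) := by
  rw [map_coeff_eq_of_infinite (haarMean N) p (C (haarMean N f) * X ^ J) infinite_norm_eq_one]
  · rw [coeff_C_mul_X_pow, if_pos rfl]
  · intro w hw
    rw [h w hw, ← Algebra.smul_def, map_smul, haarMean_leftTranslate, smul_eq_mul, eval_mul,
      eval_C, eval_pow, eval_X, mul_comm]
    rfl

/-- `det (1 - w U) ^ l` has constant term `1` as a polynomial in `w`. -/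
theorem haarMean_det_one_sub_pow (l : ℕ) :
    haarMean N ((1 - genericU N).det ^ l) = 1 := by
  rw [haarMean_eq_haarMean_coeff _ ((1 - (X : (UFun N)[X]) • (genericU N).map C).det ^ l) 0]
  · rw [coeff_zero_eq_eval_zero, eval_pow, ← coe_evalRingHom, RingHom.map_det, map_sub, map_one]
    have : (evalRingHom (0 : UFun N)).mapMatrix ((X : (UFun N)[X]) • (genericU N).map C) = 0 := by
      ext1 i j
      rw [RingHom.mapMatrix_apply, map_apply, Matrix.smul_apply, smul_eq_mul, coe_evalRingHom,
        eval_mul, eval_X, zero_mul, Matrix.zero_apply]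
    rw [this, sub_zero, det_one, one_pow, haarMean_one]
  · intro w hw
    rw [pow_zero, map_one, one_mul, map_pow, eval_pow, AlgHom.map_det, map_sub, map_one,
      AlgHom.mapMatrix_apply, leftTranslate_scalarU_genericU, ← coe_evalRingHom, RingHom.map_det,
      map_sub, map_one]
    congr 3
    ext1 i j
    rw [RingHom.mapMatrix_apply, map_apply, Matrix.smul_apply, Matrix.smul_apply, smul_eq_mul,
      smul_eq_mul, coe_evalRingHom, eval_mul, eval_X, map_apply, eval_C]

theorem eval_charMoment {n : ℕ} (m : ℕ) (x : Fin n → ℂ) :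
    MvPolynomial.eval x (charMoment N n m) =
      haarMean N ((∏ r, (genericU N).charpoly.eval (algebraMap ℂ (UFun N) (x r))) *
        invDet N ^ m) := by
  rw [charMoment, eval_coeffwise, map_mul, map_prod, MvPolynomial.eval_C]
  congr 2
  refine Finset.prod_congr rfl fun r _ => ?_
  rw [charFactor_eq_aeval, aeval_def, hom_eval₂, MvPolynomial.eval_X]
  have : (MvPolynomial.eval fun i => algebraMap ℂ (UFun N) (x i)).comp
      (algebraMap (UFun N) (MvPolynomial (Fin n) (UFun N))) = RingHom.id _ := by
    ext1 a
    rw [MvPolynomial.algebraMap_eq, RingHom.comp_apply, MvPolynomial.eval_C]; rfl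
  rw [this]
  rfl

theorem det_toeplitz_X_sub_one_pow (l m : ℕ) :
    (of fun i j : Fin N => (((X : ℂ[X]) ^ m * (X - 1) ^ l) * X ^ (j : ℕ)).coeff (m + i)).det =
      (-1) ^ (N * l) := by
  rw [det_of_isLowerTriangular]
  · have h : ∀ i : Fin N, (((X : ℂ[X]) ^ m * (X - 1) ^ l) * X ^ (i : ℕ)).coeff (m + i) =
        (-1) ^ l := by
      intro i
      rw [coeff_mul_X_pow, ← zero_add m, zero_add m, coeff_X_pow_mul', if_pos le_rfl, Nat.sub_self,
        coeff_zero_eq_eval_zero]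
      simp
    simp only [of_apply, h, Finset.prod_const, Finset.card_univ, Fintype.card_fin]
    rw [← pow_mul, mul_comm]
  · intro i j hij
    have hij' : (i : ℕ) < j := hij
    rw [of_apply, mul_assoc, coeff_X_pow_mul', if_pos (by omega), coeff_mul_X_pow',
      if_neg (by omega)]

theorem haarMean_prod_charpoly {n m : ℕ} (hmn : m ≤ n) (x : Fin n → ℂ) :
    haarMean N ((∏ r, (genericU N).charpoly.eval (algebraMap ℂ (UFun N) (x r))) *
        invDet N ^ m) = (-1) ^ (N * n) *
      (of fun i j : Fin N => ((∏ r : Fin n, (X - C (x r))) * X ^ (j : ℕ)).coeff (m + i)).det := by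
  obtain ⟨c, hc⟩ := exists_charMoment_eq (N := N) m hmn
  have key : ∀ y : Fin n → ℂ,
      haarMean N ((∏ r, (genericU N).charpoly.eval (algebraMap ℂ (UFun N) (y r))) *
        invDet N ^ m) = c *
      (of fun i j : Fin N => ((∏ r : Fin n, (X - C (y r))) * X ^ (j : ℕ)).coeff (m + i)).det := by
    intro y
    rw [← eval_charMoment, hc, map_mul, MvPolynomial.eval_C, RingHom.map_det]
    congr 2
    ext1 i j
    rw [RingHom.mapMatrix_apply, map_apply, of_apply, of_apply, ← coeff_map]
    congr 1
    simp [Polynomial.map_prod]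
  rw [key x]
  congr 1
  obtain ⟨l, rfl⟩ := Nat.exists_eq_add_of_le hmn
  -- The constant is determined at `x = (0, …, 0, 1, …, 1)`, with `m` zeros: the left-hand side is
  -- the mean of `± det (1 - U) ^ l`, and the matrix on the right is triangular.
  have h := key (Fin.append (fun _ : Fin m => 0) (fun _ : Fin l => 1))
  have hG : (∏ r : Fin (m + l), (X - C (Fin.append (fun _ : Fin m => (0 : ℂ))
      (fun _ : Fin l => 1) r))) = X ^ m * (X - 1) ^ l := by
    simp [Fin.prod_univ_add]
  rw [hG, det_toeplitz_X_sub_one_pow, Fin.prod_univ_add] at h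
  simp only [Fin.append_left, Fin.append_right, Finset.prod_const, Finset.card_univ,
    Fintype.card_fin, map_zero, map_one, eval_charpoly, zero_sub] at h
  have h0 : ((-genericU N).det ^ m * (1 - genericU N).det ^ l) * invDet N ^ m =
      ((-1 : ℂ) ^ (N * m)) • (1 - genericU N).det ^ l := by
    rw [det_neg, Fintype.card_fin, mul_right_comm, ← mul_pow, mul_assoc, det_genericU_mul_invDet,
      mul_one, ← pow_mul, Algebra.smul_def]
    simp
  rw [h0, map_smul, haarMean_det_one_sub_pow, smul_eq_mul, mul_one] at h
  have h1 : ((-1 : ℂ) ^ (N * l)) * (-1) ^ (N * l) = 1 := by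
    rw [← mul_pow]; simp
  rw [mul_add, pow_add, h, mul_assoc, h1, mul_one]

/-- The function `U ↦ det p(U)`, as a multiplicative map in the polynomial `p`. -/
noncomputable def detAeval (N : ℕ) : ℂ[X] →* UFun N :=
  detMonoidHom.comp (aeval (R := ℂ) (genericU N) : ℂ[X] →* Matrix (Fin N) (Fin N) (UFun N))

theorem detAeval_apply (P : ℂ[X]) : detAeval N P = (aeval (genericU N) P).det := rfl

theorem algebraMap_matrix_UFun (c : ℂ) :
    algebraMap ℂ (Matrix (Fin N) (Fin N) (UFun N)) c = scalar (Fin N) (algebraMap ℂ (UFun N) c) :=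
  rfl

theorem detAeval_C (c : ℂ) : detAeval N (C c) = algebraMap ℂ (UFun N) (c ^ N) := by
  rw [detAeval_apply, aeval_C, algebraMap_matrix_UFun, scalar_apply, det_diagonal,
    Finset.prod_const, Finset.card_univ, Fintype.card_fin, map_pow]

theorem detAeval_X_sub_C (x : ℂ) : detAeval N (X - C x) =
    (-1) ^ N * (genericU N).charpoly.eval (algebraMap ℂ (UFun N) x) := by
  rw [detAeval_apply, map_sub, aeval_X, aeval_C, algebraMap_matrix_UFun, eval_charpoly, ← neg_sub,
    det_neg, Fintype.card_fin]

/-- The Heine–Szegő identity: the Toeplitz determinant with symbol `P(z) z^{-m}` is the mean of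
`det (P(U) U^{-m})` over the unitary group. -/
theorem haarMean_detAeval (P : ℂ[X]) {m : ℕ} (hm : m ≤ P.natDegree) :
    haarMean N (detAeval N P * invDet N ^ m) =
      (of fun i j : Fin N => (P * X ^ (j : ℕ)).coeff (m + i)).det := by
  have hsplit := (IsAlgClosed.splits P)
  obtain ⟨n, x, hn, hP⟩ : ∃ (n : ℕ) (x : Fin n → ℂ), n = P.natDegree ∧
      P = C P.leadingCoeff * ∏ r, (X - C (x r)) := by
    refine ⟨P.roots.toList.length, fun r => P.roots.toList.get r, ?_, ?_⟩
    · rw [Multiset.length_toList, ← hsplit.natDegree_eq_card_roots]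
    · conv_lhs => rw [hsplit.eq_prod_roots]
      congr 1
      rw [← List.prod_ofFn]
      conv_lhs => rw [← Multiset.coe_toList P.roots, Multiset.map_coe, Multiset.prod_coe]
      congr 1
      conv_lhs => rw [← List.ofFn_get P.roots.toList]
      rw [List.map_ofFn]
      rfl
  rw [← hn] at hm
  generalize P.leadingCoeff = c at hP
  have h1 : ((-1 : UFun N) ^ N) ^ n = algebraMap ℂ (UFun N) ((-1) ^ (N * n)) := by
    rw [← pow_mul]; simp
  have h2 : ((-1 : ℂ) ^ (N * n)) * (-1) ^ (N * n) = 1 := by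
    rw [← mul_pow]; simp
  have hdet : (of fun i j : Fin N => (P * X ^ (j : ℕ)).coeff (m + i)).det =
      c ^ N * (of fun i j : Fin N =>
        ((∏ r, (X - C (x r))) * X ^ (j : ℕ)).coeff (m + i)).det := by
    refine Eq.trans ?_ ((det_smul _ c).trans (by rw [Fintype.card_fin]))
    congr 1
    ext1 i j
    rw [of_apply, Matrix.smul_apply, of_apply, smul_eq_mul, hP, mul_assoc, coeff_C_mul]
  rw [hdet]
  have : detAeval N P = algebraMap ℂ (UFun N) (c ^ N * (-1) ^ (N * n)) *
      ∏ r, (genericU N).charpoly.eval (algebraMap ℂ (UFun N) (x r)) := by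
    conv_lhs => rw [hP]
    rw [map_mul, map_prod, detAeval_C]
    simp only [detAeval_X_sub_C]
    rw [Finset.prod_mul_distrib, Finset.prod_const, Finset.card_univ, Fintype.card_fin, h1,
      ← mul_assoc, ← map_mul]
  rw [this, mul_assoc, ← Algebra.smul_def, map_smul, haarMean_prod_charpoly hm, smul_eq_mul]
  linear_combination (c ^ N * (of fun i j : Fin N =>
        ((∏ r, (X - C (x r))) * X ^ (j : ℕ)).coeff (m + i)).det) * h2

end HeineSzegoNormalised

/-! ### Means of determinants times traces -/

section InverseToeplitz

open Matrix Polynomial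

variable {N : ℕ}

/-- The lower triangular Toeplitz matrix of a power series. -/
noncomputable def lowerToeplitz (N : ℕ) (f : PowerSeries ℂ) : Matrix (Fin N) (Fin N) ℂ :=
  of fun i j => PowerSeries.coeff (i : ℕ) (f * PowerSeries.X ^ (j : ℕ))

theorem lowerToeplitz_apply (f : PowerSeries ℂ) (i j : Fin N) :
    lowerToeplitz N f i j = if j ≤ i then PowerSeries.coeff ((i : ℕ) - j) f else 0 := by
  rw [lowerToeplitz, of_apply, PowerSeries.coeff_mul_X_pow']
  rfl

theorem lowerToeplitz_mul (f g : PowerSeries ℂ) :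
    lowerToeplitz N f * lowerToeplitz N g = lowerToeplitz N (f * g) := by
  ext i j
  rw [mul_apply, lowerToeplitz, lowerToeplitz, lowerToeplitz]
  simp only [of_apply]
  rw [mul_assoc, mul_comm f, PowerSeries.coeff_mul, Finset.Nat.sum_antidiagonal_eq_sum_range_succ
    (fun a b => PowerSeries.coeff a (g * PowerSeries.X ^ (j : ℕ)) * PowerSeries.coeff b f),
    Fin.sum_univ_eq_sum_range (fun l => PowerSeries.coeff (i : ℕ) (f * PowerSeries.X ^ l) *
      PowerSeries.coeff l (g * PowerSeries.X ^ (j : ℕ)))]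
  symm
  refine Finset.sum_subset_zero_on_sdiff (Finset.range_subset_range.mpr i.2) ?_ ?_
  · intro l hl
    have : (i : ℕ) < l := by simp at hl; omega
    rw [PowerSeries.coeff_mul_X_pow', if_neg (by omega), zero_mul]
  · intro l hl
    have : l ≤ i := by simp at hl; omega
    rw [PowerSeries.coeff_mul_X_pow' f, if_pos this, mul_comm]

theorem lowerToeplitz_one : lowerToeplitz N 1 = 1 := by
  ext i j
  rw [lowerToeplitz, of_apply, one_mul, PowerSeries.coeff_X_pow, one_apply]
  simp [Fin.ext_iff]

theorem det_lowerToeplitz (f : PowerSeries ℂ) :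
    (lowerToeplitz N f).det = PowerSeries.coeff 0 f ^ N := by
  rw [det_of_isLowerTriangular]
  · simp [lowerToeplitz_apply]
  · intro i j hij
    exact (lowerToeplitz_apply f i j).trans (if_neg (not_le.mpr hij))

/-- The mean of `det P(U) tr (U* ^ J)`, from the coefficient of `ε` in the Heine–Szegő identity for
`P * (T ^ J + ε)`. -/
theorem haarMean_detAeval_mul_trace (P : ℂ[X]) (hP : P.coeff 0 = 1) (q : PowerSeries ℂ)
    (hq : q * (P : PowerSeries ℂ) = 1) (J : ℕ) :
    haarMean N (detAeval N P * ((genericU N)ᴴ ^ J).trace) =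
      (lowerToeplitz N q * of fun i j : Fin N => (P * X ^ (j : ℕ)).coeff (J + i)).trace := by
  have hP0 : P ≠ 0 := by rintro rfl; simp at hP
  set S : Matrix (Fin N) (Fin N) ℂ := of fun i j : Fin N => (P * X ^ (j : ℕ)).coeff (J + i) with hS
  have h := map_coeff_eq_of_infinite (haarMean N)
    (C (detAeval N P) * (1 + (X : (UFun N)[X]) • ((genericU N)ᴴ ^ J).map C).det)
    (1 + (X : ℂ[X]) • (lowerToeplitz N q * S).map C).det Set.infinite_univ ?_ 1
  · rwa [coeff_C_mul, coeff_det_one_add_X_smul_one, coeff_det_one_add_X_smul_one] at h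
  intro w _
  have hdeg : J ≤ (P * (X ^ J + C w)).natDegree := by
    rcases Nat.eq_zero_or_pos J with rfl | hJ
    · exact Nat.zero_le _
    · rw [natDegree_mul hP0 (X_pow_add_C_ne_zero hJ w), natDegree_X_pow_add_C]
      exact Nat.le_add_left _ _
  have hHS := haarMean_detAeval (N := N) _ hdeg
  have hUU : (genericU N) ^ J * (genericU N)ᴴ ^ J = 1 := by
    have hc : Commute (genericU N) (genericU N)ᴴ := by
      rw [commute_iff_eq, genericU_mul_conjTranspose, mul_eq_one_comm.mp
        (genericU_mul_conjTranspose N)]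
    rw [← hc.mul_pow, genericU_mul_conjTranspose, one_pow]
  have hl : detAeval N (P * (X ^ J + C w)) * invDet N ^ J =
      (C (detAeval N P) * (1 + (X : (UFun N)[X]) • ((genericU N)ᴴ ^ J).map C).det).eval
        (algebraMap ℂ (UFun N) w) := by
    rw [map_mul, mul_assoc, detAeval_apply (X ^ J + C w), invDet, ← det_pow, ← det_mul, map_add,
      map_pow, aeval_X, aeval_C, algebraMap_matrix_UFun, add_mul, hUU, eval_mul, eval_C,
      ← coe_evalRingHom, RingHom.map_det, map_add, map_one]
    congr 3
    ext1 i j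
    rw [RingHom.mapMatrix_apply, map_apply, Matrix.smul_apply, smul_eq_mul, coe_evalRingHom,
      eval_mul, eval_X, map_apply, eval_C, scalar_apply, diagonal_mul]
  rw [← hl, hHS, ← coe_evalRingHom, RingHom.map_det, map_add, map_one]
  have hT : lowerToeplitz N q * lowerToeplitz N (P : PowerSeries ℂ) = 1 := by
    rw [lowerToeplitz_mul, hq, lowerToeplitz_one]
  have hdetT : (lowerToeplitz N (P : PowerSeries ℂ)).det = 1 := by
    rw [det_lowerToeplitz, Polynomial.coeff_coe, hP, one_pow]
  have hdetq : (lowerToeplitz N q).det = 1 := by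
    have := congrArg det hT
    rwa [det_mul, hdetT, mul_one, det_one] at this
  have hmat : (of fun i j : Fin N => (P * (X ^ J + C w) * X ^ (j : ℕ)).coeff (J + i)) =
      lowerToeplitz N (P : PowerSeries ℂ) + w • S := by
    ext i j
    rw [Matrix.add_apply, Matrix.smul_apply, of_apply, hS, of_apply, lowerToeplitz, of_apply,
      mul_add, add_mul, coeff_add, mul_right_comm, add_comm J, coeff_mul_X_pow, mul_assoc P,
      mul_comm (C w), ← mul_assoc, coeff_mul_C, smul_eq_mul, mul_comm w, ← Polynomial.coeff_coe]
    simp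
  rw [hmat, ← one_mul (Matrix.det _), ← hdetq, ← det_mul, mul_add, hT]
  congr 2
  ext i j
  rw [Matrix.mul_smul, Matrix.smul_apply, RingHom.mapMatrix_apply, map_apply, Matrix.smul_apply,
    map_apply, smul_eq_mul, smul_eq_mul, coe_evalRingHom, eval_mul, eval_X, eval_C]
  rfl

theorem sum_coeff_mul_one_sub_X (f : PowerSeries ℂ) (n : ℕ) :
    ∑ l ∈ Finset.range (n + 1), PowerSeries.coeff l (f * (1 - PowerSeries.X)) =
      PowerSeries.coeff n f := by
  induction n with
  | zero => simp [mul_sub]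
  | succ n ih =>
    rw [Finset.sum_range_succ, ih, mul_sub, mul_one, map_sub, PowerSeries.coeff_succ_mul_X]
    ring

theorem sum_coeff_mul_X_pow (P : ℂ[X]) {i j L : ℕ} (hij : j ≤ i) (hL : P.natDegree + i < L + j) :
    ∑ J ∈ Finset.range L, (P * X ^ i).coeff (J + j) = P.eval 1 := by
  have h : P.eval 1 = (P * X ^ i).eval 1 := by simp
  have hd : (P * X ^ i).natDegree < L + j := by
    refine lt_of_le_of_lt natDegree_mul_le ?_
    rwa [natDegree_X_pow]
  rw [h, eval_eq_sum_range' hd]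
  simp only [one_pow, mul_one]
  rw [add_comm L, Finset.sum_range_add, Finset.sum_eq_zero (s := Finset.range j), zero_add]
  · simp only [add_comm j]
  · intro l hl
    rw [coeff_mul_X_pow', if_neg]
    simp at hl; omega

/-- Summing over `J`, every entry on or below the diagonal contributes `P(1)`, so that the trace
becomes `P(1)` times the sum of all entries of the inverse Toeplitz matrix. -/
theorem haarMean_sum_detAeval_mul_trace (P : ℂ[X]) (hP : P.coeff 0 = 1) (h : PowerSeries ℂ)
    (hh : h * ((P : PowerSeries ℂ) * (1 - PowerSeries.X) ^ 2) = 1) (hN : 1 ≤ N) {L : ℕ}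
    (hL : P.natDegree + N ≤ L) :
    haarMean N (∑ J ∈ Finset.range L, detAeval N P * ((genericU N)ᴴ ^ J).trace) =
      P.eval 1 * PowerSeries.coeff (N - 1) h := by
  set q : PowerSeries ℂ := h * (1 - PowerSeries.X) * (1 - PowerSeries.X) with hqd
  have hq : q * (P : PowerSeries ℂ) = 1 := by rw [hqd]; linear_combination hh
  rw [map_sum]
  simp only [haarMean_detAeval_mul_trace P hP q hq]
  simp only [trace, diag_apply, mul_apply, of_apply]
  rw [Finset.sum_comm]
  have hin : ∀ i : Fin N, ∑ J ∈ Finset.range L, ∑ j : Fin N, lowerToeplitz N q i j *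
      (P * X ^ (i : ℕ)).coeff (J + j) = P.eval 1 * PowerSeries.coeff i (h * (1 - PowerSeries.X)) := by
    intro i
    rw [Finset.sum_comm, ← sum_coeff_mul_one_sub_X, ← hqd, Finset.mul_sum]
    have : ∀ j : Fin N, ∑ J ∈ Finset.range L, lowerToeplitz N q i j *
        (P * X ^ (i : ℕ)).coeff (J + j) =
        if (j : ℕ) ≤ i then P.eval 1 * PowerSeries.coeff ((i : ℕ) - j) q else 0 := by
      intro j
      rw [← Finset.mul_sum, lowerToeplitz_apply]
      by_cases hji : j ≤ i
      · rw [if_pos hji, if_pos (show (j : ℕ) ≤ i from hji), sum_coeff_mul_X_pow P hji (by omega),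
          mul_comm]
      · rw [if_neg hji, if_neg (show ¬ (j : ℕ) ≤ i from hji), zero_mul]
    rw [Finset.sum_congr rfl fun j _ => this j, Fin.sum_univ_eq_sum_range (fun j =>
      if j ≤ (i : ℕ) then P.eval 1 * PowerSeries.coeff ((i : ℕ) - j) q else 0),
      ← Finset.sum_range_reflect _ ((i : ℕ) + 1)]
    symm
    refine Finset.sum_subset_zero_on_sdiff (Finset.range_subset_range.mpr i.2) ?_ ?_
    · intro l hl
      rw [if_neg]
      simp at hl; omega
    · intro l hl
      have : l ≤ i := by simp at hl; omega
      rw [if_pos this, Nat.add_sub_cancel]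
  rw [Finset.sum_congr rfl fun i _ => hin i, Fin.sum_univ_eq_sum_range (fun i =>
    P.eval 1 * PowerSeries.coeff i (h * (1 - PowerSeries.X))), ← Finset.mul_sum]
  obtain ⟨n, rfl⟩ := Nat.exists_eq_add_of_le' hN
  rw [sum_coeff_mul_one_sub_X, Nat.add_sub_cancel]

end InverseToeplitz

/-! ### Complete homogeneous symmetric polynomials -/

section CompleteHomogeneous

theorem mk_pow_mul_one_sub (a : ℂ) : (PowerSeries.mk fun q => a ^ q) *
    (1 - PowerSeries.C a * PowerSeries.X) = 1 := by
  ext q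
  rw [mul_sub, mul_one, ← mul_assoc, map_sub, PowerSeries.coeff_mk, PowerSeries.coeff_one]
  cases q with
  | zero => simp
  | succ q => simp [pow_succ]

/-- The generating function of the complete homogeneous symmetric polynomials. -/
theorem mk_hsymm_mul_prod {n : ℕ} (y : Fin n → ℂ) :
    (PowerSeries.mk fun q => MvPolynomial.eval y (MvPolynomial.hsymm (Fin n) ℂ q)) *
      ∏ r, (1 - PowerSeries.C (y r) * PowerSeries.X) = 1 := by
  have hmk : (PowerSeries.mk fun q => MvPolynomial.eval y (MvPolynomial.hsymm (Fin n) ℂ q)) =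
      ∏ r, PowerSeries.mk fun q => y r ^ q := by
    ext d
    rw [PowerSeries.coeff_mk, PowerSeries.coeff_prod, MvPolynomial.hsymm, map_sum]
    refine Finset.sum_nbij (fun s => Multiset.toFinsupp s.1) ?_ ?_ ?_ ?_
    · intro s _
      rw [Finset.mem_finsuppAntidiag]
      refine ⟨?_, Finset.subset_univ _⟩
      change ∑ i, Multiset.count i s.1 = d
      rw [Multiset.sum_count_eq_card (fun a _ => Finset.mem_univ a)]
      exact s.2
    · intro s _ t _ hst
      exact Subtype.ext (Multiset.toFinsupp.injective hst)
    · intro l hl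
      rw [Finset.mem_coe, Finset.mem_finsuppAntidiag] at hl
      refine ⟨⟨Finsupp.toMultiset l, ?_⟩, Finset.mem_coe.mpr (Finset.mem_univ _), ?_⟩
      · rw [Finsupp.card_toMultiset, ← hl.1, Finsupp.sum_fintype _ _ (fun _ => rfl)]
        rfl
      · exact Finsupp.toMultiset_toFinsupp l
    · intro s _
      simp only [PowerSeries.coeff_mk, Multiset.toFinsupp_apply]
      rw [map_multiset_prod, Multiset.map_map]
      simp only [Function.comp_def, MvPolynomial.eval_X]
      rw [Finset.prod_multiset_map_count]
      refine Finset.prod_subset (Finset.subset_univ _) fun i _ hi => ?_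
      rw [Multiset.count_eq_zero_of_notMem (by simpa using hi), pow_zero]
  rw [hmk, ← Finset.prod_mul_distrib]
  exact Finset.prod_eq_one fun r _ => mk_pow_mul_one_sub _

/-- The polynomial `∏ r, (1 - a_r T)`. -/
noncomputable def reciprocalProd {k : ℕ} (a : Fin k → ℂ) : Polynomial ℂ :=
  ∏ r, (1 - Polynomial.C (a r) * Polynomial.X)

theorem reciprocalProd_coe {k : ℕ} (a : Fin k → ℂ) :
    (reciprocalProd a : PowerSeries ℂ) = ∏ r, (1 - PowerSeries.C (a r) * PowerSeries.X) := by
  rw [reciprocalProd, ← Polynomial.coeToPowerSeries.ringHom_apply, map_prod]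
  simp

theorem coeff_zero_reciprocalProd {k : ℕ} (a : Fin k → ℂ) : (reciprocalProd a).coeff 0 = 1 := by
  rw [Polynomial.coeff_zero_eq_eval_zero, reciprocalProd, Polynomial.eval_prod]
  simp

theorem eval_one_reciprocalProd {k : ℕ} (a : Fin k → ℂ) :
    (reciprocalProd a).eval 1 = ∏ r, (1 - a r) := by
  rw [reciprocalProd, Polynomial.eval_prod]
  simp

theorem mk_hsymm_append_mul {k : ℕ} (a : Fin k → ℂ) :
    (PowerSeries.mk fun q => MvPolynomial.eval (Fin.append a (fun _ : Fin 2 => (1 : ℂ)))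
      (MvPolynomial.hsymm (Fin (k + 2)) ℂ q)) *
      ((reciprocalProd a : PowerSeries ℂ) * (1 - PowerSeries.X) ^ 2) = 1 := by
  have h := mk_hsymm_mul_prod (Fin.append a (fun _ : Fin 2 => (1 : ℂ)))
  rw [Fin.prod_univ_add] at h
  simp only [Fin.append_left, Fin.append_right, Finset.prod_const, Finset.card_univ,
    Fintype.card_fin, map_one, one_mul] at h
  rwa [reciprocalProd_coe]

end CompleteHomogeneous

/-! ### Traces of powers as eigenvalue sums -/

section EigenvalueSums

open Matrix Polynomial

variable {N : ℕ}

/-- Both sides are multiplicative in `p`, so it suffices to compare them on linear factors. -/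
theorem det_aeval_eq_prod_roots (M : Matrix (Fin N) (Fin N) ℂ) (p : ℂ[X]) :
    (aeval M p).det = (M.charpoly.roots.map fun t => p.eval t).prod := by
  have hs := IsAlgClosed.splits M.charpoly
  have hcard : M.charpoly.roots.card = N := by
    rw [← hs.natDegree_eq_card_roots, charpoly_natDegree_eq_dim, Fintype.card_fin]
  set φ : ℂ[X] →* ℂ := detMonoidHom.comp (aeval (R := ℂ) M : ℂ[X] →* Matrix (Fin N) (Fin N) ℂ)
    with hφ
  let ψ : ℂ[X] →* ℂ :=
    { toFun := fun p => (M.charpoly.roots.map fun t => p.eval t).prod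
      map_one' := by simp
      map_mul' := fun p q => by
        rw [← Multiset.prod_map_mul]
        simp only [eval_mul] }
  have hψ : ∀ p, ψ p = (M.charpoly.roots.map fun t => p.eval t).prod := fun _ => rfl
  have hC : ∀ c : ℂ, φ (C c) = ψ (C c) := by
    intro c
    have h1 : φ (C c) = (aeval M (C c)).det := rfl
    rw [h1, aeval_C, Algebra.algebraMap_eq_smul_one, det_smul, det_one, mul_one, hψ]
    simp [hcard]
  have hX : ∀ a : ℂ, φ (X - C a) = ψ (X - C a) := by
    intro a
    have h1 : φ (X - C a) = (aeval M (X - C a)).det := rfl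
    have h2 : M.charpoly.eval a = (M.charpoly.roots.map fun t => a - t).prod := by
      conv_lhs => rw [hs.eq_prod_roots_of_monic (charpoly_monic M)]
      rw [eval_multiset_prod, Multiset.map_map]
      simp
    rw [h1, map_sub, aeval_X, aeval_C, ← neg_sub, det_neg,
      show algebraMap ℂ (Matrix (Fin N) (Fin N) ℂ) a = scalar (Fin N) a from rfl,
      ← eval_charpoly, h2, hψ, Fintype.card_fin]
    have h3 := Multiset.prod_map_neg (M.charpoly.roots.map fun t => a - t)
    rw [Multiset.card_map, hcard, Multiset.map_map] at h3
    rw [← h3]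
    simp
  have h : φ p = ψ p := by
    rw [(IsAlgClosed.splits p).eq_prod_roots, map_mul, map_mul, hC, map_multiset_prod,
      map_multiset_prod, Multiset.map_map, Multiset.map_map]
    congr 2
    exact Multiset.map_congr rfl fun a _ => hX a
  exact h

theorem coeff_prod_one_add_X_mul (s : Multiset ℂ) :
    ((s.map fun t => (1 : ℂ[X]) + X * C t).prod).coeff 0 = 1 ∧
      ((s.map fun t => (1 : ℂ[X]) + X * C t).prod).coeff 1 = s.sum := by
  induction s using Multiset.induction_on with
  | empty => simp [coeff_one]
  | cons a s ih =>
    rw [Multiset.map_cons, Multiset.prod_cons, Multiset.sum_cons, add_mul, one_mul, mul_assoc]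
    constructor
    · rw [coeff_add, ih.1, coeff_X_mul_zero, add_zero]
    · rw [coeff_add, ih.2, coeff_X_mul, coeff_C_mul, ih.1, mul_one, add_comm]

/-- The coefficient of `w` in `det (1 + w M ^ J)`, computed by `det_aeval_eq_prod_roots`. -/
theorem trace_pow_eq_sum_roots (M : Matrix (Fin N) (Fin N) ℂ) (J : ℕ) :
    (M ^ J).trace = (M.charpoly.roots.map fun t => t ^ J).sum := by
  have h := map_coeff_eq_of_infinite (LinearMap.id : ℂ →ₗ[ℂ] ℂ)
    (1 + (X : ℂ[X]) • (M ^ J).map C).det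
    ((M.charpoly.roots.map fun t => t ^ J).map fun t => (1 : ℂ[X]) + X * C t).prod
    Set.infinite_univ ?_ 1
  · rwa [(coeff_prod_one_add_X_mul _).2, coeff_det_one_add_X_smul_one, LinearMap.id_apply] at h
  · intro w _
    have h1 := det_aeval_eq_prod_roots M (1 + C w * X ^ J)
    rw [LinearMap.id_apply, eval_multiset_prod, Multiset.map_map, Multiset.map_map,
      ← coe_evalRingHom, RingHom.map_det]
    refine Eq.trans ?_ (h1.trans ?_)
    · congr 1
      rw [map_add, map_one, map_add, map_one, map_mul, map_pow, aeval_X, aeval_C,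
        ← Algebra.smul_def]
      congr 1
      ext i j
      rw [RingHom.mapMatrix_apply, map_apply, Matrix.smul_apply, map_apply, smul_eq_mul,
        coe_evalRingHom, eval_mul, eval_X, eval_C]
      rfl
    · congr 1
      refine Multiset.map_congr rfl fun t _ => ?_
      change eval t (1 + C w * X ^ J) = eval w (1 + X * C (t ^ J))
      simp

open scoped Matrix.Norms.L2Operator in
theorem norm_eq_one_of_mem_roots_charpoly (U : Matrix.unitaryGroup (Fin N) ℂ) {t : ℂ}
    (ht : t ∈ (U : Matrix (Fin N) (Fin N) ℂ).charpoly.roots) : ‖t‖ = 1 := by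
  have h : t ∈ spectrum ℂ (U : Matrix (Fin N) (Fin N) ℂ) :=
    mem_spectrum_iff_isRoot_charpoly.mpr (isRoot_of_mem_roots ht)
  exact spectrum.norm_eq_one_of_unitary U.2 h

theorem trace_conjTranspose_pow (U : Matrix.unitaryGroup (Fin N) ℂ) (J : ℕ) :
    ((U : Matrix (Fin N) (Fin N) ℂ)ᴴ ^ J).trace =
      ((U : Matrix (Fin N) (Fin N) ℂ).charpoly.roots.map fun t => (star t) ^ J).sum := by
  rw [← conjTranspose_pow, trace_conjTranspose, trace_pow_eq_sum_roots, ← starAddEquiv_apply,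
    map_multiset_sum, Multiset.map_map]
  simp

end EigenvalueSums

/-! ### Invariance under the centre -/

section RotatedProduct

open Matrix Polynomial

variable {N k : ℕ}

/-- The polynomial `∏ r, det (1 - a_r T U)` in `T`, with coefficients functions of `U`. -/
noncomputable def dilatedDet (N : ℕ) (a : Fin k → ℂ) : (UFun N)[X] :=
  ∏ r, (1 - (X * C (algebraMap ℂ (UFun N) (a r))) • (genericU N).map C).det

theorem eval_dilatedDet (a : Fin k → ℂ) (f : UFun N) :
    (dilatedDet N a).eval f =
      ∏ r, (1 - (f * algebraMap ℂ (UFun N) (a r)) • genericU N).det := by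
  rw [dilatedDet, eval_prod]
  refine Finset.prod_congr rfl fun r _ => ?_
  rw [← coe_evalRingHom, RingHom.map_det, map_sub, map_one]
  congr 2
  ext1 i j
  rw [RingHom.mapMatrix_apply, map_apply, Matrix.smul_apply, Matrix.smul_apply, smul_eq_mul,
    smul_eq_mul, coe_evalRingHom, eval_mul, eval_mul, eval_X, eval_C, map_apply, eval_C]

theorem detAeval_reciprocalProd (a : Fin k → ℂ) : detAeval N (reciprocalProd a) =
    ∏ r, (1 - algebraMap ℂ (UFun N) (a r) • genericU N).det := by
  rw [reciprocalProd, map_prod]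
  refine Finset.prod_congr rfl fun r _ => ?_
  rw [detAeval_apply, map_sub, map_one, map_mul, aeval_X, aeval_C, algebraMap_matrix_UFun,
    scalar_apply]
  congr 2
  ext1 i j
  rw [diagonal_mul, Matrix.smul_apply, smul_eq_mul]

theorem leftTranslate_scalarU_conjTranspose (w : ℂ) (hw : ‖w‖ = 1) :
    ((genericU N)ᴴ).map (leftTranslate (scalarU N w hw)) =
      algebraMap ℂ (UFun N) (star w) • (genericU N)ᴴ := by
  ext i j U
  have h := congrFun (congrFun (leftTranslate_scalarU_genericU w hw) j) i
  have h1 := congrArg (fun f : UFun N => star (f U)) h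
  refine Eq.trans ?_ (h1.trans ?_)
  · rfl
  · change star (w * _) = star w * star _
    rw [star_mul']
    rfl

/-- By invariance under the centre of `U(N)`, only the terms of degree zero in `U` contribute to
the mean. -/
theorem haarMean_coeff_dilatedDet_mul_trace (a : Fin k → ℂ) (J : ℕ) :
    haarMean N ((dilatedDet N a).coeff J * ((genericU N)ᴴ ^ J).trace) =
      haarMean N (detAeval N (reciprocalProd a) * ((genericU N)ᴴ ^ J).trace) := by
  rw [haarMean_eq_haarMean_coeff (detAeval N _ * _) (dilatedDet N a * C ((genericU N)ᴴ ^ J).trace) J,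
    coeff_mul_C]
  intro w hw
  have htr : leftTranslate (scalarU N w hw) ((genericU N)ᴴ ^ J).trace =
      algebraMap ℂ (UFun N) (star w ^ J) * ((genericU N)ᴴ ^ J).trace := by
    rw [AddMonoidHom.map_trace, ← AlgHom.mapMatrix_apply, map_pow, AlgHom.mapMatrix_apply,
      leftTranslate_scalarU_conjTranspose, _root_.smul_pow, trace_smul, map_pow, smul_eq_mul]
  have hww : w ^ J * star w ^ J = 1 := by
    rw [← mul_pow, RCLike.star_def, Complex.mul_conj', hw]; simp
  rw [map_mul, htr, detAeval_reciprocalProd, map_prod, eval_mul, eval_C, eval_dilatedDet,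
    mul_left_comm, ← mul_assoc (algebraMap ℂ (UFun N) (w ^ J)), ← map_mul, hww, map_one, one_mul]
  congr 1
  refine Finset.prod_congr rfl fun r _ => ?_
  rw [AlgHom.map_det, map_sub, map_one, AlgHom.mapMatrix_apply]
  congr 2
  have h := leftTranslate_scalarU_genericU (N := N) w hw
  ext1 i j
  rw [map_apply, Matrix.smul_apply, Matrix.smul_apply, smul_eq_mul, smul_eq_mul, map_mul,
    AlgHom.commutes, ← map_apply (f := leftTranslate (scalarU N w hw)), h, Matrix.smul_apply,
    smul_eq_mul]
  ring

/-- The function `∑ n, ∏ r, det (1 - a_r λ_n⁻¹ U)` of `U`, expanded in powers of `λ_n⁻¹` and written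
with the traces of powers of `U*`; the truncation at `L` is harmless once `L` exceeds the degree of
`dilatedDet N a`. -/
noncomputable def eigenSum (N L : ℕ) (a : Fin k → ℂ) : UFun N :=
  ∑ J ∈ Finset.range L, (dilatedDet N a).coeff J * ((genericU N)ᴴ ^ J).trace

theorem eigenSum_apply {L : ℕ} (a : Fin k → ℂ) (hL : (dilatedDet N a).natDegree < L)
    (U : Matrix.unitaryGroup (Fin N) ℂ) :
    eigenSum N L a U = ((U : Matrix (Fin N) (Fin N) ℂ).charpoly.roots.map fun t =>
      ∏ r, (1 - (star t * a r) • (U : Matrix (Fin N) (Fin N) ℂ)).det).sum := by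
  set ev : UFun N →ₐ[ℂ] ℂ := ContinuousMap.evalAlgHom ℂ ℂ U with hev
  have hU : (genericU N).map ev = (U : Matrix (Fin N) (Fin N) ℂ) := rfl
  have hUs : ((genericU N)ᴴ).map ev = (U : Matrix (Fin N) (Fin N) ℂ)ᴴ := rfl
  have h1 : eigenSum N L a U = ∑ J ∈ Finset.range L, ev ((dilatedDet N a).coeff J) *
      ((U : Matrix (Fin N) (Fin N) ℂ).charpoly.roots.map fun t => (star t) ^ J).sum := by
    have : eigenSum N L a U = ev (eigenSum N L a) := rfl
    rw [this, eigenSum, map_sum]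
    refine Finset.sum_congr rfl fun J _ => ?_
    rw [map_mul, AddMonoidHom.map_trace, ← AlgHom.mapMatrix_apply, map_pow, AlgHom.mapMatrix_apply,
      hUs, trace_conjTranspose_pow]
  have h2 : ∀ t : ℂ, ∏ r, (1 - (star t * a r) • (U : Matrix (Fin N) (Fin N) ℂ)).det =
      ∑ J ∈ Finset.range L, ev ((dilatedDet N a).coeff J) * star t ^ J := by
    intro t
    have h3 : ev ((dilatedDet N a).eval (algebraMap ℂ (UFun N) (star t))) =
        ∏ r, (1 - (star t * a r) • (U : Matrix (Fin N) (Fin N) ℂ)).det := by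
      rw [eval_dilatedDet, map_prod]
      refine Finset.prod_congr rfl fun r _ => ?_
      rw [AlgHom.map_det, map_sub, map_one, AlgHom.mapMatrix_apply]
      congr 2
    rw [← h3, eval_eq_sum_range' hL, map_sum]
    refine Finset.sum_congr rfl fun J _ => ?_
    rw [map_mul, ← map_pow, AlgHom.commutes]
    rfl
  rw [h1]
  simp only [h2]
  induction (U : Matrix (Fin N) (Fin N) ℂ).charpoly.roots using Multiset.induction_on with
  | empty => simp
  | cons t s ih =>
    simp only [Multiset.map_cons, Multiset.sum_cons, mul_add, Finset.sum_add_distrib]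
    rw [ih]

end RotatedProduct

/-! ### The mean over the eigenangles -/

section ShiftedMean

variable {N k : ℕ}

/-- The choice of arguments in `eigenangles` is immaterial, as `exp (-i arg λ) = λ⁻¹` for
`|λ| = 1`. -/
theorem shiftedMean_eq_eigenSum {L : ℕ} (α : Fin k → ℂ)
    (hL : (dilatedDet N fun r => Complex.exp (-Complex.I * α r)).natDegree < L)
    (U : Matrix.unitaryGroup (Fin N) ℂ) :
    shiftedMean α U =
      1 / (N : ℂ) * eigenSum N L (fun r => Complex.exp (-Complex.I * α r)) U := by
  rw [eigenSum_apply _ hL, shiftedMean, eigenangles, Multiset.map_map]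
  congr 2
  refine Multiset.map_congr rfl fun t ht => Finset.prod_congr rfl fun r _ => ?_
  have h1 : ‖t‖ = 1 := norm_eq_one_of_mem_roots_charpoly U ht
  have ht : t = Complex.exp (t.arg * Complex.I) := by
    conv_lhs => rw [← Complex.norm_mul_exp_arg_mul_I t, h1, Complex.ofReal_one, one_mul]
  have hstar : star t = Complex.exp (-Complex.I * t.arg) := by
    conv_lhs => rw [ht]
    rw [Complex.star_def, ← Complex.exp_conj, map_mul, Complex.conj_ofReal, Complex.conj_I]
    congr 1; ring
  rw [Z, hstar, ← Complex.exp_add, mul_add]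

theorem haarMean_eigenSum (hN : 1 ≤ N) {L : ℕ} (a : Fin k → ℂ)
    (hL : (reciprocalProd a).natDegree + N ≤ L) :
    haarMean N (eigenSum N L a) = (∏ r, (1 - a r)) *
      MvPolynomial.eval (Fin.append a (fun _ : Fin 2 => (1 : ℂ)))
        (MvPolynomial.hsymm (Fin (k + 2)) ℂ (N - 1)) := by
  have h := haarMean_sum_detAeval_mul_trace (reciprocalProd a) (coeff_zero_reciprocalProd a) _
    (mk_hsymm_append_mul a) hN hL
  rw [PowerSeries.coeff_mk, eval_one_reciprocalProd, map_sum] at h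
  rw [← h, eigenSum, map_sum]
  exact Finset.sum_congr rfl fun J _ => haarMean_coeff_dilatedDet_mul_trace a J

theorem integrable_shiftedMean (α : Fin k → ℂ) :
    Integrable (fun U : Matrix.unitaryGroup (Fin N) ℂ => shiftedMean α U) (haarU N) := by
  simp only [shiftedMean_eq_eigenSum α (Nat.lt_succ_self _)]
  exact (integrable_haarU _).const_mul _

theorem integral_shiftedMean (hN : 1 ≤ N) (α : Fin k → ℂ) :
    ∫ U, shiftedMean α U ∂(haarU N) =
      1 / (N : ℂ) * (∏ r, (1 - Complex.exp (-Complex.I * α r))) *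
        MvPolynomial.eval
          (Fin.append (fun r => Complex.exp (-Complex.I * α r)) (fun _ : Fin 2 => (1 : ℂ)))
          (MvPolynomial.hsymm (Fin (k + 2)) ℂ (N - 1)) := by
  set a : Fin k → ℂ := fun r => Complex.exp (-Complex.I * α r) with ha
  have hL : (dilatedDet N a).natDegree <
      (dilatedDet N a).natDegree + 1 + ((reciprocalProd a).natDegree + N) := by omega
  simp only [shiftedMean_eq_eigenSum α hL]
  rw [integral_const_mul, ← ha, ← haarMean_apply, haarMean_eigenSum hN a (by omega), mul_assoc]

end ShiftedMean

/-! ### Partial fractions and the closed form -/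

section ClosedForm

open Polynomial

variable {k : ℕ}

theorem sq_dvd_of_eval_eq_zero {q : ℂ[X]} {c : ℂ} (h0 : q.eval c = 0)
    (h1 : (derivative q).eval c = 0) : (X - C c) ^ 2 ∣ q := by
  obtain ⟨p, rfl⟩ := dvd_iff_isRoot.mpr h0
  rw [derivative_mul, eval_add, eval_mul, eval_mul] at h1
  have hp : p.eval c = 0 := by simpa using h1
  obtain ⟨p', rfl⟩ := dvd_iff_isRoot.mpr hp
  exact ⟨p', by ring⟩

/-- The coefficient of `(1 - a_r T)⁻¹` in the partial fraction expansion of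
`∏ j, (1 - a_j) / (1 - a_j T) * (1 - T)⁻²`. -/
noncomputable def partialFractionCoeff (a : Fin k → ℂ) (r : Fin k) : ℂ :=
  a r ^ (k + 1) / (1 - a r) * ∏ j ∈ Finset.univ.erase r, (1 - a j) / (a r - a j)

theorem natDegree_prod_one_sub_le (a : Fin k → ℂ) (s : Finset (Fin k)) :
    (∏ r ∈ s, (1 - C (a r) * X)).natDegree ≤ s.card := by
  refine (natDegree_prod_le _ _).trans ?_
  rw [Finset.card_eq_sum_ones]
  exact Finset.sum_le_sum fun r _ => by compute_degree

/-- The partial fraction expansion, cleared of denominators: both sides agree to second order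
at `1`, and at the `k` points `a_r⁻¹`. -/
theorem sum_partialFractionCoeff (a : Fin k → ℂ) (h0 : ∀ r, a r ≠ 0) (h1 : ∀ r, a r ≠ 1)
    (hinj : ∀ r j, r ≠ j → a r ≠ a j) :
    ∑ r, C (partialFractionCoeff a r) * ((∏ j ∈ Finset.univ.erase r, (1 - C (a j) * X)) *
        (1 - X) ^ 2) + C (k - ∑ l, 1 / (1 - a l)) * (reciprocalProd a * (1 - X)) +
      reciprocalProd a = C (∏ j, (1 - a j)) := by
  have h1' : ∀ r, 1 - a r ≠ 0 := fun r => sub_ne_zero.mpr (h1 r).symm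
  rw [← sub_eq_zero]
  generalize hq : (_ - _ : ℂ[X]) = q
  symm at hq
  have hdeg : q.natDegree ≤ k + 1 := by
    have hP : (reciprocalProd a).natDegree ≤ k := by
      simpa [reciprocalProd] using natDegree_prod_one_sub_le a Finset.univ
    have hX : (1 - X : ℂ[X]).natDegree ≤ 1 := by compute_degree
    have hX2 : ((1 - X : ℂ[X]) ^ 2).natDegree ≤ 2 := natDegree_pow_le_of_le 2 hX
    rw [hq, natDegree_sub_C]
    refine natDegree_add_le_of_degree_le (natDegree_add_le_of_degree_le
      (natDegree_sum_le_of_forall_le _ _ fun r _ => ?_) ?_) (hP.trans (Nat.le_succ k))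
    · refine (natDegree_C_mul_le _ _).trans (natDegree_mul_le.trans ?_)
      have h2 := natDegree_prod_one_sub_le a (Finset.univ.erase r)
      rw [Finset.card_erase_of_mem (Finset.mem_univ r), Finset.card_univ, Fintype.card_fin] at h2
      have := r.pos
      omega
    · exact (natDegree_C_mul_le _ _).trans (natDegree_mul_le.trans (add_le_add hP hX))
  have hroot : ∀ r, q.eval (a r)⁻¹ = 0 := by
    intro r
    have hPr : (reciprocalProd a).eval (a r)⁻¹ = 0 := by
      rw [reciprocalProd, eval_prod]
      refine Finset.prod_eq_zero (Finset.mem_univ r) ?_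
      simp [h0 r]
    rw [hq, eval_sub, eval_add, eval_add, eval_mul, eval_mul, hPr, eval_finsetSum,
      Finset.sum_eq_single r]
    · rw [eval_mul, eval_C, eval_mul, eval_prod, eval_C, partialFractionCoeff,
        ← Finset.mul_prod_erase Finset.univ (fun j => 1 - a j) (Finset.mem_univ r),
        Finset.prod_div_distrib]
      have hprod : ∏ j ∈ Finset.univ.erase r, (1 - C (a j) * X).eval (a r)⁻¹ =
          (∏ j ∈ Finset.univ.erase r, (a r - a j)) * ((a r)⁻¹) ^ (k - 1) := by
        have hcard : (Finset.univ.erase r).card = k - 1 := by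
          rw [Finset.card_erase_of_mem (Finset.mem_univ r), Finset.card_univ, Fintype.card_fin]
        rw [← hcard, ← Finset.prod_const, ← Finset.prod_mul_distrib]
        refine Finset.prod_congr rfl fun j _ => ?_
        simp [sub_mul, h0 r]
      have hne : ∏ j ∈ Finset.univ.erase r, (a r - a j) ≠ 0 :=
        Finset.prod_ne_zero_iff.mpr fun j hj =>
          sub_ne_zero.mpr (hinj r j (Finset.ne_of_mem_erase hj).symm)
      rw [hprod]
      obtain ⟨l, hl⟩ := Nat.exists_eq_add_of_le' r.pos
      have hk : k - 1 = l := by omega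
      have hk' : a r ^ (k + 1) = a r ^ (l + 2) := by rw [hl]
      rw [hk, hk', eval_C]
      have := h0 r
      have := h1' r
      simp only [eval_pow, eval_sub, eval_one, eval_X, inv_pow]
      field_simp
      ring
    · intro s _ hs
      rw [eval_mul, eval_mul, eval_prod, Finset.prod_eq_zero (i := r)]
      · simp
      · exact Finset.mem_erase.mpr ⟨hs.symm, Finset.mem_univ r⟩
      · simp [h0 r]
    · intro h; exact absurd (Finset.mem_univ r) h
  have hq1 : q.eval 1 = 0 := by
    rw [hq, eval_sub, eval_add, eval_add, eval_finsetSum, eval_one_reciprocalProd, eval_C]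
    simp
  have hq2 : (derivative q).eval 1 = 0 := by
    have hd : (derivative (reciprocalProd a)).eval 1 =
        (k - ∑ l, 1 / (1 - a l)) * ∏ j, (1 - a j) := by
      rw [reciprocalProd, derivative_prod_finset, eval_finsetSum]
      have : ((k : ℂ) - ∑ l, 1 / (1 - a l)) = ∑ l, (1 - 1 / (1 - a l)) := by
        simp [Finset.sum_sub_distrib]
      rw [this, Finset.sum_mul]
      refine Finset.sum_congr rfl fun r _ => ?_
      rw [← Finset.mul_prod_erase Finset.univ (fun j => 1 - a j) (Finset.mem_univ r), eval_mul,
        eval_prod]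
      have := h1' r
      simp only [derivative_sub, derivative_one, derivative_mul, derivative_C, derivative_X,
        eval_sub, eval_one, eval_mul, eval_C, eval_X, zero_mul, zero_add, mul_one, zero_sub,
        eval_neg]
      field_simp
      ring
    rw [hq, derivative_sub, derivative_add, derivative_add, eval_sub, eval_add, eval_add,
      derivative_C, derivative_C_mul, derivative_mul, derivative_sum, eval_finsetSum, hd]
    rw [Finset.sum_eq_zero]
    · rw [eval_mul, eval_C, eval_add, eval_mul, eval_mul, eval_one_reciprocalProd]
      simp
    · intro r _
      rw [derivative_C_mul, derivative_mul, derivative_pow]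
      simp
  obtain ⟨p, hp⟩ := sq_dvd_of_eval_eq_zero hq1 hq2
  have hp0 : p = 0 := by
    refine Polynomial.eq_zero_of_degree_lt_of_eval_index_eq_zero Finset.univ
      (v := fun r : Fin k => (a r)⁻¹) ?_ ?_ ?_
    · intro r _ s _ hrs
      by_contra hne
      exact hinj r s hne (inv_injective hrs)
    · by_cases hp0 : p = 0
      · rw [hp0, degree_zero]; exact WithBot.bot_lt_coe _
      · rw [hp, natDegree_mul (pow_ne_zero _ (X_sub_C_ne_zero 1)) hp0, natDegree_pow,
          natDegree_X_sub_C] at hdeg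
        rw [degree_eq_natDegree hp0, Finset.card_univ, Fintype.card_fin]
        exact_mod_cast (by omega : p.natDegree < k)
    · intro r _
      have := hroot r
      rw [hp, eval_mul, mul_eq_zero] at this
      refine this.resolve_left ?_
      simp only [eval_pow, eval_sub, eval_X, eval_C]
      refine pow_ne_zero _ (sub_ne_zero.mpr fun h => h1 r ?_)
      rw [← inv_inv (a r), h, inv_one]
  rw [hp, hp0, mul_zero]

theorem prod_mul_eval_hsymm (a : Fin k → ℂ) (h0 : ∀ r, a r ≠ 0) (h1 : ∀ r, a r ≠ 1)
    (hinj : ∀ r j, r ≠ j → a r ≠ a j) (m : ℕ) :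
    (∏ r, (1 - a r)) * MvPolynomial.eval (Fin.append a (fun _ : Fin 2 => (1 : ℂ)))
        (MvPolynomial.hsymm (Fin (k + 2)) ℂ m) =
      ∑ r, partialFractionCoeff a r * a r ^ m + (k - ∑ l, 1 / (1 - a l)) + (m + 1) := by
  have hsum := sum_partialFractionCoeff a h0 h1 hinj
  generalize ∏ j, (1 - a j) = c at hsum ⊢
  generalize (k : ℂ) - ∑ l, 1 / (1 - a l) = A at hsum ⊢
  generalize partialFractionCoeff a = e at hsum ⊢
  set H : PowerSeries ℂ := PowerSeries.mk fun q =>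
    MvPolynomial.eval (Fin.append a (fun _ : Fin 2 => (1 : ℂ)))
      (MvPolynomial.hsymm (Fin (k + 2)) ℂ q) with hH
  have hHP := mk_hsymm_append_mul a
  rw [← hH] at hHP
  set g : ℂ → PowerSeries ℂ := fun c => PowerSeries.mk fun q => c ^ q with hg
  have hgeom : ∀ c, g c * (1 - PowerSeries.C c * PowerSeries.X) = 1 := mk_pow_mul_one_sub
  have hg1 : g 1 * (1 - PowerSeries.X) = 1 := by simpa using hgeom 1
  have hg2 : (PowerSeries.mk fun q => (q : ℂ) + 1) * (1 - PowerSeries.X) = g 1 := by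
    ext q
    rw [mul_sub, mul_one, map_sub, PowerSeries.coeff_mk]
    cases q with
    | zero => simp [hg]
    | succ q => simp [hg]
  have hpf := congrArg (Polynomial.coeToPowerSeries.ringHom (R := ℂ)) hsum
  simp only [map_add, map_sum, map_mul, map_prod, map_pow, map_sub, map_one] at hpf
  simp only [Polynomial.coeToPowerSeries.ringHom_apply, Polynomial.coe_C, Polynomial.coe_X] at hpf
  have hF : ∑ r, PowerSeries.C (e r) * g (a r) + PowerSeries.C A * g 1 +
      PowerSeries.mk (fun q => (q : ℂ) + 1) = PowerSeries.C c * H := by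
    set D : PowerSeries ℂ := (reciprocalProd a : PowerSeries ℂ) * (1 - PowerSeries.X) ^ 2 with hD
    suffices h : (∑ r, PowerSeries.C (e r) * g (a r) + PowerSeries.C A * g 1 +
        PowerSeries.mk (fun q => (q : ℂ) + 1)) * D = PowerSeries.C c by
      rw [← h, mul_assoc, mul_comm D, hHP, mul_one]
    have hr : ∀ r, g (a r) * D = (∏ j ∈ Finset.univ.erase r,
        (1 - PowerSeries.C (a j) * PowerSeries.X)) * (1 - PowerSeries.X) ^ 2 := by
      intro r
      rw [hD, reciprocalProd_coe, ← Finset.mul_prod_erase _ _ (Finset.mem_univ r)]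
      linear_combination (∏ j ∈ Finset.univ.erase r,
        (1 - PowerSeries.C (a j) * PowerSeries.X)) * (1 - PowerSeries.X) ^ 2 * hgeom (a r)
    have h1D : g 1 * D = (reciprocalProd a : PowerSeries ℂ) * (1 - PowerSeries.X) := by
      rw [hD]
      linear_combination (reciprocalProd a : PowerSeries ℂ) * (1 - PowerSeries.X) * hg1
    have h2D : PowerSeries.mk (fun q => (q : ℂ) + 1) * D = (reciprocalProd a : PowerSeries ℂ) := by
      rw [hD]
      linear_combination (reciprocalProd a : PowerSeries ℂ) * ((1 - PowerSeries.X) * hg2 + hg1)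
    rw [← hpf, add_mul, add_mul, Finset.sum_mul, mul_assoc _ (g 1), h1D, h2D]
    simp only [mul_assoc, hr]
  have h := congrArg (PowerSeries.coeff m) hF
  simpa [hH, hg, eq_comm] using h

end ClosedForm

theorem theorem2 (N k : ℕ) (hN : 1 ≤ N) (α : Fin k → ℂ) :
    Integrable (fun U : Matrix.unitaryGroup (Fin N) ℂ => shiftedMean α U) (haarU N) ∧
    ∫ U, shiftedMean α U ∂(haarU N) =
      1 / (N : ℂ) * (∏ r, (1 - Complex.exp (-Complex.I * α r))) *
        MvPolynomial.eval
          (Fin.append (fun r => Complex.exp (-Complex.I * α r)) (fun _ : Fin 2 => (1 : ℂ)))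
          (MvPolynomial.hsymm (Fin (k + 2)) ℂ (N - 1)) ∧
    ((∀ r, Complex.exp (-Complex.I * α r) ≠ 1) →
      (∀ r j, r ≠ j → Complex.exp (-Complex.I * α r) ≠ Complex.exp (-Complex.I * α j)) →
      ∫ U, shiftedMean α U ∂(haarU N) =
        1 / (N : ℂ) *
          ((∑ r, Complex.exp (-Complex.I * ((N : ℂ) + (k : ℂ)) * α r) /
                (1 - Complex.exp (-Complex.I * α r)) *
              ∏ j ∈ Finset.univ.erase r, (1 - Complex.exp (-Complex.I * α j)) /
                (Complex.exp (-Complex.I * α r) - Complex.exp (-Complex.I * α j))) +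
            (N : ℂ) + (k : ℂ) - ∑ l, 1 / (1 - Complex.exp (-Complex.I * α l)))) := by
  refine ⟨integrable_shiftedMean α, integral_shiftedMean hN α, fun h1 hinj => ?_⟩
  rw [integral_shiftedMean hN, mul_assoc,
    prod_mul_eval_hsymm _ (fun r => Complex.exp_ne_zero _) h1 hinj]
  congr 1
  have hN' : ((N - 1 : ℕ) : ℂ) + 1 = N := by
    rw [← Nat.cast_succ, Nat.succ_eq_add_one, Nat.sub_add_cancel hN]
  have hpow : ∀ r, Complex.exp (-Complex.I * ((N : ℂ) + (k : ℂ)) * α r) =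
      Complex.exp (-Complex.I * α r) ^ (k + 1) * Complex.exp (-Complex.I * α r) ^ (N - 1) := by
    intro r
    rw [← pow_add, ← Complex.exp_nat_mul, show k + 1 + (N - 1) = N + k by omega]
    congr 1
    push_cast
    ring
  rw [hN']
  have hsum : ∑ r, partialFractionCoeff (fun r => Complex.exp (-Complex.I * α r)) r *
      Complex.exp (-Complex.I * α r) ^ (N - 1) =
      ∑ r, Complex.exp (-Complex.I * ((N : ℂ) + (k : ℂ)) * α r) /
                (1 - Complex.exp (-Complex.I * α r)) *
              ∏ j ∈ Finset.univ.erase r, (1 - Complex.exp (-Complex.I * α j)) /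
                (Complex.exp (-Complex.I * α r) - Complex.exp (-Complex.I * α j)) :=
    Finset.sum_congr rfl fun r _ => by rw [partialFractionCoeff, hpow]; ring
  rw [hsum]
  ring
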